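/- Let $X$ and $Y$ be smooth manifolds (finite-dimensional, Hausdorff, second countable) and let $f\colon X\to Y$ be a surjective submersion. For $p\ge 0$ let $$N_p=\{(x_0,\dots,x_p)\in X^{p+1} : f(x_0)=\dots=f(x_p)\}$$ be the $(p+1)$-fold fibre product of $X$ over $Y$, with its manifold structure; the $N_p$ form the nerve $X_\bullet$ of the Lie groupoid $X\times_Y X\rightrightarrows X$, with face maps $d_i$ omitting $x_i$ and degeneracy maps $s_i$ repeating $x_i$. Let $\widehat\Omega^q(N_p)$ be the space of normalised $q$-forms on $N_p$, that is, smooth $q$-forms $\alpha$ with $s_i^*\alpha=0$ for all degeneracy maps $s_i\colon N_{p-1}\to N_p$ (no condition if $p=0$). For $k\ge 0$ put $F^k\widehat\Omega^q(N_p)=\widehat\Omega^q(N_p)$ if $q\ge k$ and $0$ if $q<k$. The $k$-truncated total cohomology $H_D^n(X_\bullet,F^k\widehat\Omega^\bullet)$, $n\ge 0$, is the cohomology of the total complex $$\bigoplus_{p+q=n}F^k\widehat\Omega^q(N_p),\qquad D=\delta+(-1)^p d\ \text{ on }\ \widehat\Omega^q(N_p),\qquad \delta=\sum_{i=0}^{p+1}(-1)^i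 d_i^*\colon \widehat\Omega^q(N_p)\to\widehat\Omega^q(N_{p+1}),$$ where $d$ is the exterior derivative. The $k$-truncated de Rham cohomology $H_{dR}^n(Y,F^k\Omega^\bullet)$ is the cohomology of the complex $(F^k\Omega^\bullet(Y),d)$ with $F^k\Omega^q(Y)=\Omega^q(Y)$ if $q\ge k$ and $0$ if $q<k$. Then, for every $k\ge 0$ and every $n\ge 0$, the pullback $f^*\colon F^k\Omega^n(Y)\to F^k\widehat\Omega^n(X)=F^k\widehat\Omega^n(N_0)$ induces an isomorphism $$H_{dR}^n(Y,F^k\Omega^\bullet)\;\xrightarrow{\ \cong\ }\;H_D^n(X_\bullet,F^k\widehat\Omega^\bullet),\qquad [\omega]\mapsto[f^*\omega].$$ -/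

import Mathlib

open Set Manifold Topology
open scoped ContDiff

namespace CechDescent

section Forms

variable {E : Type*} [NormedAddCommGroup E] [NormedSpace ℝ E]
  {M : Type*} [TopologicalSpace M] [ChartedSpace E M]
  {E' : Type*} [NormedAddCommGroup E'] [NormedSpace ℝ E']
  {N : Type*} [TopologicalSpace N] [ChartedSpace E' N]

variable (E M) in
/-- Families of alternating `q`-forms on the tangent spaces of `M`, without any regularity. -/
abbrev RawForm (q : ℕ) := (x : M) → TangentSpace 𝓘(ℝ, E) x [⋀^Fin q]→L[ℝ] ℝ

/-- The form `α` written in the preferred chart `φ` at `x₀`: the pullback of `α` along `φ⁻¹`, a form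
on the open subset `φ.target` of the model space. -/
noncomputable def inChart {q : ℕ} (α : RawForm E M q) (x₀ : M) : E → E [⋀^Fin q]→L[ℝ] ℝ := fun z =>
  (α ((chartAt E x₀).symm z)).compContinuousLinearMap
    (mfderiv 𝓘(ℝ, E) 𝓘(ℝ, E) (chartAt E x₀).symm z)

variable (E M) in
/-- The subspace of smooth differential `q`-forms: those whose expressions in the charts are smooth. -/
def smoothForms (q : ℕ) : Submodule ℝ (RawForm E M q) where
  carrier := {α | ∀ x₀ : M, ContDiffOn ℝ ∞ (inChart α x₀) (chartAt E x₀).target}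
  add_mem' ha hb x₀ := (ha x₀).add (hb x₀)
  zero_mem' _ := contDiffOn_const (c := 0)
  smul_mem' c _ ha x₀ := (ha x₀).const_smul c

/-- The pullback of `α` along `f`. -/
noncomputable def rawPullback {q : ℕ} (f : M → N) (α : RawForm E' N q) : RawForm E M q := fun x =>
  (α (f x)).compContinuousLinearMap (mfderiv 𝓘(ℝ, E) 𝓘(ℝ, E') f x)

/-- The exterior derivative of `α`: at `x`, the exterior derivative of `α` in the chart `φ` at `x`,
pulled back along `φ`. -/
noncomputable def rawD {q : ℕ} (α : RawForm E M q) : RawForm E M (q + 1) := fun x =>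
  (extDeriv (inChart α x) (chartAt E x x)).compContinuousLinearMap
    (mfderiv 𝓘(ℝ, E) 𝓘(ℝ, E) (chartAt E x) x)

theorem minSmoothness_two_le : minSmoothness ℝ 2 ≤ (∞ : ℕ∞ω) := by
  rw [minSmoothness_of_isRCLikeNormedField]
  exact WithTop.coe_le_coe.2 (le_top : (2 : ℕ∞) ≤ ⊤)

open ContinuousMultilinearMap in
theorem contDiff_comp_aux (q : ℕ) : ContDiff ℝ ∞
    (fun p : (E' [⋀^Fin q]→L[ℝ] ℝ) × (E →L[ℝ] E') => p.1.compContinuousLinearMap p.2) := by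
  let A : ContinuousMultilinearMap ℝ (fun _ : Fin q => E) ℝ →ₗ[ℝ] E [⋀^Fin q]→L[ℝ] ℝ :=
    { toFun := fun m => alternatization m
      map_add' := map_add _
      map_smul' := fun c m => by
        ext v
        simp [alternatization_apply_apply, Finset.mul_sum, Units.smul_def] 
        refine Finset.sum_congr rfl fun σ _ => by ring }
  have hA : ∀ m, ‖A m‖ ≤ (Fintype.card (Equiv.Perm (Fin q)) : ℝ) * ‖m‖ := fun m => by
    refine ContinuousAlternatingMap.opNorm_le_bound _ (by positivity) fun v => ?_
    change ‖alternatization m v‖ ≤ _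
    rw [alternatization_apply_apply]
    refine (norm_sum_le _ _).trans ?_
    have : ∀ σ ∈ (Finset.univ : Finset (Equiv.Perm (Fin q))),
        ‖Equiv.Perm.sign σ • m (v ∘ σ)‖ ≤ ‖m‖ * ∏ i, ‖v i‖ := fun σ _ => by
      have h1 : ‖Equiv.Perm.sign σ • m (v ∘ σ)‖ = ‖m (v ∘ σ)‖ := by
        rcases Int.units_eq_one_or (Equiv.Perm.sign σ) with h | h <;> simp [h]
      rw [h1, ← Equiv.prod_comp σ]
      exact m.le_opNorm _
    refine (Finset.sum_le_sum this).trans ?_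
    simp [mul_assoc]
  let A' := A.mkContinuous _ hA
  let c : ℝ := ((q.factorial : ℝ))⁻¹
  have key : (fun p : (E' [⋀^Fin q]→L[ℝ] ℝ) × (E →L[ℝ] E') => p.1.compContinuousLinearMap p.2) =
      fun p => c • A' (compContinuousLinearMapContinuousMultilinear ℝ (fun _ : Fin q => E)
        (fun _ : Fin q => E') ℝ (fun _ => p.2)
        (ContinuousAlternatingMap.toContinuousMultilinearMapCLM ℝ p.1)) := by
    funext p
    ext v
    have : ∀ σ : Equiv.Perm (Fin q), p.1 (fun i => p.2 (v (σ i))) =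
        Equiv.Perm.sign σ • p.1 (fun i => p.2 (v i)) := fun σ =>
      p.1.toAlternatingMap.map_perm (fun i => p.2 (v i)) σ
    change p.1 (fun i => p.2 (v i)) = c • alternatization _ v
    rw [alternatization_apply_apply]
    change p.1 (fun i => p.2 (v i)) = c • ∑ σ : Equiv.Perm (Fin q), Equiv.Perm.sign σ •
      p.1 (fun i => p.2 (v (σ i)))
    simp_rw [this, smul_smul]
    simp [c, Fintype.card_perm, ← mul_assoc]
    rw [inv_mul_cancel₀ (by exact_mod_cast q.factorial_ne_zero), one_mul]
  rw [key]
  refine ContDiff.const_smul _ (A'.contDiff.comp ?_)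
  exact ((ContinuousMultilinearMap.contDiff _).comp (contDiff_pi.2 fun _ => contDiff_snd)).clm_apply
    ((ContinuousLinearMap.contDiff _).comp contDiff_fst)

theorem contMDiffOn_chart_inv [IsManifold 𝓘(ℝ, E) ∞ M] (x : M) :
    ContMDiffOn 𝓘(ℝ, E) 𝓘(ℝ, E) ∞ (chartAt E x).symm (chartAt E x).target :=
  contMDiffOn_chart_symm

theorem mdiffAt_chart_inv [IsManifold 𝓘(ℝ, E) ∞ M] (x : M) {z : E} (hz : z ∈ (chartAt E x).target) :
    MDifferentiableAt 𝓘(ℝ, E) 𝓘(ℝ, E) (chartAt E x).symm z :=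
  ((contMDiffOn_chart_inv x).contMDiffAt ((chartAt E x).open_target.mem_nhds hz)).mdifferentiableAt
    (by simp)

theorem mdiffAt_chart [IsManifold 𝓘(ℝ, E) ∞ M] (x : M) {y : M} (hy : y ∈ (chartAt E x).source) :
    MDifferentiableAt 𝓘(ℝ, E) 𝓘(ℝ, E) (chartAt E x) y :=
  ((contMDiffOn_chart (n := ∞)).contMDiffAt
    ((chartAt E x).open_source.mem_nhds hy)).mdifferentiableAt (by simp)

theorem inChart_rawPullback [IsManifold 𝓘(ℝ, E) ∞ M] [IsManifold 𝓘(ℝ, E') ∞ N] {q : ℕ} {f : M → N}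
    (hf : ContMDiff 𝓘(ℝ, E) 𝓘(ℝ, E') ∞ f) (α : RawForm E' N q) (x₀ : M) (y₀ : N) {z : E}
    (hz : z ∈ (chartAt E x₀).target) (hy : f ((chartAt E x₀).symm z) ∈ (chartAt E' y₀).source) :
    inChart (rawPullback f α) x₀ z =
      (inChart α y₀ (chartAt E' y₀ (f ((chartAt E x₀).symm z)))).compContinuousLinearMap
        (fderiv ℝ (chartAt E' y₀ ∘ f ∘ (chartAt E x₀).symm) z) := by
  set φ := chartAt E x₀
  set ψ := chartAt E' y₀
  have h1 : MDifferentiableAt 𝓘(ℝ, E) 𝓘(ℝ, E) φ.symm z := mdiffAt_chart_inv x₀ hz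
  have h2 : MDifferentiableAt 𝓘(ℝ, E) 𝓘(ℝ, E') f (φ.symm z) := hf.mdifferentiableAt (by simp)
  have h3 : MDifferentiableAt 𝓘(ℝ, E') 𝓘(ℝ, E') ψ (f (φ.symm z)) := mdiffAt_chart y₀ hy
  have h4 : MDifferentiableAt 𝓘(ℝ, E') 𝓘(ℝ, E') ψ.symm (ψ (f (φ.symm z))) :=
    mdiffAt_chart_inv y₀ (ψ.map_source hy)
  have h12 : MDifferentiableAt 𝓘(ℝ, E) 𝓘(ℝ, E') (f ∘ φ.symm) z := h2.comp z h1
  have h123 : MDifferentiableAt 𝓘(ℝ, E) 𝓘(ℝ, E') (ψ ∘ f ∘ φ.symm) z :=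
    MDifferentiableAt.comp (g := ψ) (f := f ∘ φ.symm) z h3 h12
  have e1 : mfderiv 𝓘(ℝ, E) 𝓘(ℝ, E') (f ∘ φ.symm) z =
      (mfderiv 𝓘(ℝ, E) 𝓘(ℝ, E') f (φ.symm z)).comp (mfderiv 𝓘(ℝ, E) 𝓘(ℝ, E) φ.symm z) :=
    mfderiv_comp z h2 h1
  have e2 : mfderiv 𝓘(ℝ, E) 𝓘(ℝ, E') (ψ.symm ∘ (ψ ∘ f ∘ φ.symm)) z =
      (mfderiv 𝓘(ℝ, E') 𝓘(ℝ, E') ψ.symm (ψ (f (φ.symm z)))).comp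
        (mfderiv 𝓘(ℝ, E) 𝓘(ℝ, E') (ψ ∘ f ∘ φ.symm) z) :=
    mfderiv_comp (f := ψ ∘ f ∘ φ.symm) z h4 h123
  have ev : (ψ.symm ∘ (ψ ∘ f ∘ φ.symm)) =ᶠ[𝓝 z] f ∘ φ.symm := by
    have : (f ∘ φ.symm) ⁻¹' ψ.source ∈ 𝓝 z :=
      h12.continuousAt.preimage_mem_nhds (ψ.open_source.mem_nhds hy)
    filter_upwards [this] with w hw
    exact ψ.left_inv hw
  have e3 := ev.mfderiv_eq (I := 𝓘(ℝ, E)) (I' := 𝓘(ℝ, E'))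
  rw [e1] at e3
  have e4 : ψ.symm (ψ (f (φ.symm z))) = f (φ.symm z) := ψ.left_inv hy
  rw [← mfderiv_eq_fderiv]
  ext v
  have key := e2.symm.trans e3
  change α (f (φ.symm z)) (fun i => ((mfderiv 𝓘(ℝ, E) 𝓘(ℝ, E') f (φ.symm z)).comp
      (mfderiv 𝓘(ℝ, E) 𝓘(ℝ, E) φ.symm z)) (v i)) =
    α (ψ.symm (ψ (f (φ.symm z)))) (fun i => ((mfderiv 𝓘(ℝ, E') 𝓘(ℝ, E') ψ.symm (ψ (f (φ.symm z)))).comp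
        (mfderiv 𝓘(ℝ, E) 𝓘(ℝ, E') (ψ ∘ f ∘ φ.symm) z)) (v i))
  have hα : ∀ (y y' : N), y = y' → ∀ w : Fin q → E', (α y : E' [⋀^Fin q]→L[ℝ] ℝ) w =
    (α y' : E' [⋀^Fin q]→L[ℝ] ℝ) w := by rintro y _ rfl w; rfl
  refine (hα _ _ e4.symm _).trans (congrArg _ ?_)
  funext i
  exact (DFunLike.congr_fun key (v i)).symm

theorem eventually_inChart_rawPullback [IsManifold 𝓘(ℝ, E) ∞ M] [IsManifold 𝓘(ℝ, E') ∞ N] {q : ℕ}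
    {f : M → N} (hf : ContMDiff 𝓘(ℝ, E) 𝓘(ℝ, E') ∞ f) (α : RawForm E' N q) (x₀ : M) (y₀ : N) {z : E}
    (hz : z ∈ (chartAt E x₀).target) (hy : f ((chartAt E x₀).symm z) ∈ (chartAt E' y₀).source) :
    inChart (rawPullback f α) x₀ =ᶠ[𝓝 z] fun w =>
      (inChart α y₀ ((chartAt E' y₀ ∘ f ∘ (chartAt E x₀).symm) w)).compContinuousLinearMap
        (fderiv ℝ (chartAt E' y₀ ∘ f ∘ (chartAt E x₀).symm) w) := by
  have h1 := (chartAt E x₀).open_target.mem_nhds hz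
  have hc : ContinuousAt (f ∘ (chartAt E x₀).symm) z :=
    (hf.continuous.continuousAt).comp ((chartAt E x₀).continuousAt_symm hz)
  filter_upwards [h1, hc.preimage_mem_nhds ((chartAt E' y₀).open_source.mem_nhds hy)] with w hw hw'
  exact inChart_rawPullback hf α x₀ y₀ hw hw'

theorem contDiffAt_coord [IsManifold 𝓘(ℝ, E) ∞ M] [IsManifold 𝓘(ℝ, E') ∞ N] {f : M → N}
    (hf : ContMDiff 𝓘(ℝ, E) 𝓘(ℝ, E') ∞ f) (x₀ : M) (y₀ : N) {z : E}
    (hz : z ∈ (chartAt E x₀).target) (hy : f ((chartAt E x₀).symm z) ∈ (chartAt E' y₀).source) :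
    ContDiffAt ℝ ∞ (chartAt E' y₀ ∘ f ∘ (chartAt E x₀).symm) z := by
  rw [← contMDiffAt_iff_contDiffAt]
  have h1 := (contMDiffOn_chart_inv x₀).contMDiffAt ((chartAt E x₀).open_target.mem_nhds hz)
  have h3 : ContMDiffAt 𝓘(ℝ, E') 𝓘(ℝ, E') ∞ (chartAt E' y₀) (f ((chartAt E x₀).symm z)) :=
    contMDiffOn_chart.contMDiffAt ((chartAt E' y₀).open_source.mem_nhds hy)
  exact ContMDiffAt.comp (g := chartAt E' y₀) (f := f ∘ (chartAt E x₀).symm) z h3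
    ((hf _).comp z h1)

theorem rawPullback_mem [IsManifold 𝓘(ℝ, E) ∞ M] [IsManifold 𝓘(ℝ, E') ∞ N] {q : ℕ} {f : M → N}
    (hf : ContMDiff 𝓘(ℝ, E) 𝓘(ℝ, E') ∞ f) {α : RawForm E' N q} (hα : α ∈ smoothForms E' N q) :
    rawPullback f α ∈ smoothForms E M q := by
  intro x₀ z hz
  set y₀ := f ((chartAt E x₀).symm z) with hy₀
  have hev := eventually_inChart_rawPullback hf α x₀ y₀ hz (mem_chart_source E' _)
  refine ContDiffAt.contDiffWithinAt (ContDiffAt.congr_of_eventuallyEq ?_ hev)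
  have hg := contDiffAt_coord hf x₀ y₀ hz (mem_chart_source E' _)
  have h1 : ContDiffAt ℝ ∞ (inChart α y₀) (chartAt E' y₀ y₀) :=
    (hα y₀).contDiffAt ((chartAt E' y₀).open_target.mem_nhds (mem_chart_target E' y₀))
  have h2 : ContDiffAt ℝ ∞ (fun w => inChart α y₀ ((chartAt E' y₀ ∘ f ∘ (chartAt E x₀).symm) w)) z :=
    ContDiffAt.comp z (g := inChart α y₀) h1 hg
  exact (contDiff_comp_aux q).contDiffAt.comp z (h2.prodMk (hg.fderiv_right (by simp)))

theorem rawPullback_id {q : ℕ} (α : RawForm E M q) : rawPullback id α = α := by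
  funext x
  ext v
  simp [rawPullback, mfderiv_id]

theorem inChart_rawD [IsManifold 𝓘(ℝ, E) ∞ M] {q : ℕ} {α : RawForm E M q} (hα : α ∈ smoothForms E M q)
    (x₀ : M) {z : E} (hz : z ∈ (chartAt E x₀).target) :
    inChart (rawD α) x₀ z = extDeriv (inChart α x₀) z := by
  set φ := chartAt E x₀
  set x := φ.symm z with hx
  set ψ := chartAt E x
  have hxs : id (φ.symm z) ∈ (chartAt E x).source := mem_chart_source E x
  have hid : ContMDiff 𝓘(ℝ, E) 𝓘(ℝ, E) ∞ (id : M → M) := contMDiff_id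
  have hev := eventually_inChart_rawPullback hid α x₀ x hz hxs
  rw [rawPullback_id] at hev
  rw [hev.extDeriv_eq]
  have hg := contDiffAt_coord hid x₀ x hz hxs
  have h1 : DifferentiableAt ℝ (inChart α x) ((ψ ∘ id ∘ φ.symm) z) :=
    ((hα x).contDiffAt ((chartAt E x).open_target.mem_nhds
      (mem_chart_target E x))).differentiableAt (by simp)
  refine Eq.trans ?_ (extDeriv_pullback h1 hg minSmoothness_two_le).symm
  rw [← mfderiv_eq_fderiv]
  have e1 : mfderiv 𝓘(ℝ, E) 𝓘(ℝ, E) (ψ ∘ φ.symm) z =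
      (mfderiv 𝓘(ℝ, E) 𝓘(ℝ, E) ψ x).comp (mfderiv 𝓘(ℝ, E) 𝓘(ℝ, E) φ.symm z) :=
    mfderiv_comp z (mdiffAt_chart x (mem_chart_source E x)) (mdiffAt_chart_inv x₀ hz)
  ext v
  change extDeriv (inChart α x) (ψ x) (fun i => ((mfderiv 𝓘(ℝ, E) 𝓘(ℝ, E) ψ x).comp
    (mfderiv 𝓘(ℝ, E) 𝓘(ℝ, E) φ.symm z)) (v i)) = extDeriv (inChart α x) (ψ x) (fun i =>
      mfderiv 𝓘(ℝ, E) 𝓘(ℝ, E) (ψ ∘ φ.symm) z (v i))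
  rw [e1]

theorem rawD_mem [IsManifold 𝓘(ℝ, E) ∞ M] {q : ℕ} {α : RawForm E M q} (hα : α ∈ smoothForms E M q) :
    rawD α ∈ smoothForms E M (q + 1) := by
  intro x₀
  refine ContDiffOn.congr ?_ (fun z hz => inChart_rawD hα x₀ hz)
  have h1 := (hα x₀).fderiv_of_isOpen (m := ∞) (chartAt E x₀).open_target (by simp)
  exact (ContinuousAlternatingMap.alternatizeUncurryFinCLM ℝ E ℝ).contDiff.comp_contDiffOn h1

theorem inChart_injective [IsManifold 𝓘(ℝ, E) ∞ M] {q : ℕ} {α β : RawForm E M q}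
    (h : ∀ (x₀ : M), ∀ z ∈ (chartAt E x₀).target, inChart α x₀ z = inChart β x₀ z) : α = β := by
  funext x
  set φ := chartAt E x
  have hx := mem_chart_source E x
  have h1 := h x (φ x) (φ.map_source hx)
  have e1 : mfderiv 𝓘(ℝ, E) 𝓘(ℝ, E) (φ.symm ∘ φ) x =
      (mfderiv 𝓘(ℝ, E) 𝓘(ℝ, E) φ.symm (φ x)).comp (mfderiv 𝓘(ℝ, E) 𝓘(ℝ, E) φ x) :=
    mfderiv_comp x (mdiffAt_chart_inv x (φ.map_source hx)) (mdiffAt_chart x hx)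
  have e2 : φ.symm ∘ φ =ᶠ[𝓝 x] id := by
    filter_upwards [φ.open_source.mem_nhds hx] with w hw using φ.left_inv hw
  rw [e2.mfderiv_eq, mfderiv_id] at e1
  have e3 : φ.symm (φ x) = x := φ.left_inv hx
  ext v
  have h2 := DFunLike.congr_fun h1 (fun i => mfderiv 𝓘(ℝ, E) 𝓘(ℝ, E) φ x (v i))
  have hc : ∀ (γ : RawForm E M q), inChart γ x (φ x) (fun i => mfderiv 𝓘(ℝ, E) 𝓘(ℝ, E) φ x (v i)) =
      γ x v := fun γ => by
    have hγ : ∀ (y y' : M), y = y' → ∀ w : Fin q → E, (γ y : E [⋀^Fin q]→L[ℝ] ℝ) w =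
      (γ y' : E [⋀^Fin q]→L[ℝ] ℝ) w := by rintro y _ rfl w; rfl
    refine (hγ _ _ e3 _).trans (congrArg _ ?_)
    funext i
    exact (DFunLike.congr_fun e1 (v i)).symm
  exact (hc α).symm.trans (h2.trans (hc β))

theorem rawD_rawPullback [IsManifold 𝓘(ℝ, E) ∞ M] [IsManifold 𝓘(ℝ, E') ∞ N] {q : ℕ} {f : M → N}
    (hf : ContMDiff 𝓘(ℝ, E) 𝓘(ℝ, E') ∞ f) {α : RawForm E' N q} (hα : α ∈ smoothForms E' N q) :
    rawD (E := E) (M := M) (rawPullback f α) = rawPullback f (rawD α) := by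
  refine inChart_injective (E := E) fun x₀ z hz => ?_
  set y₀ := f ((chartAt E x₀).symm z) with hy₀
  have hys : f ((chartAt E x₀).symm z) ∈ (chartAt E' y₀).source := mem_chart_source E' _
  rw [inChart_rawD (rawPullback_mem hf hα) x₀ hz, inChart_rawPullback hf _ x₀ y₀ hz hys,
    (eventually_inChart_rawPullback hf α x₀ y₀ hz hys).extDeriv_eq,
    inChart_rawD hα y₀ ((chartAt E' y₀).map_source hys)]
  exact extDeriv_pullback (((hα y₀).contDiffAt ((chartAt E' y₀).open_target.mem_nhds
      (mem_chart_target E' y₀))).differentiableAt (by simp)) (contDiffAt_coord hf x₀ y₀ hz hys)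
    minSmoothness_two_le

theorem rawD_rawD [IsManifold 𝓘(ℝ, E) ∞ M] {q : ℕ} {α : RawForm E M q} (hα : α ∈ smoothForms E M q) :
    rawD (rawD α) = 0 := by
  refine inChart_injective (E := E) fun x₀ z hz => ?_
  have hn := (chartAt E x₀).open_target.mem_nhds hz
  have hev : inChart (rawD α) x₀ =ᶠ[𝓝 z] extDeriv (inChart α x₀) := by
    filter_upwards [hn] with w hw using inChart_rawD hα x₀ hw
  rw [inChart_rawD (rawD_mem hα) x₀ hz, hev.extDeriv_eq,
    extDeriv_extDeriv_apply ((hα x₀).contDiffAt hn) minSmoothness_two_le]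
  rfl

variable (E M) in
/-- `Ω^q(M)`: the smooth differential `q`-forms on `M`. -/
def DiffForm (q : ℕ) : Type _ := smoothForms E M q

noncomputable instance (q : ℕ) : AddCommGroup (DiffForm E M q) :=
  inferInstanceAs (AddCommGroup (smoothForms E M q))

noncomputable instance (q : ℕ) : Module ℝ (DiffForm E M q) :=
  inferInstanceAs (Module ℝ (smoothForms E M q))

/-- The exterior derivative `d : Ω^q(M) → Ω^(q+1)(M)`. -/
noncomputable def extD [IsManifold 𝓘(ℝ, E) ∞ M] (q : ℕ) :
    DiffForm E M q →ₗ[ℝ] DiffForm E M (q + 1) where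
  toFun α := ⟨rawD α.1, rawD_mem α.2⟩
  map_add' α β := by
    refine Subtype.ext ?_
    refine inChart_injective (E := E) fun x₀ z hz => ?_
    have h : ∀ γ : DiffForm E M q, DifferentiableAt ℝ (inChart γ.1 x₀) z := fun γ =>
      ((γ.2 x₀).contDiffAt ((chartAt E x₀).open_target.mem_nhds hz)).differentiableAt (by simp)
    refine (inChart_rawD (α + β).2 x₀ hz).trans ((extDeriv_add (h α) (h β)).trans ?_)
    rw [← inChart_rawD α.2 x₀ hz, ← inChart_rawD β.2 x₀ hz]
    rfl
  map_smul' c α := by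
    refine Subtype.ext ?_
    refine inChart_injective (E := E) fun x₀ z hz => ?_
    refine (inChart_rawD (c • α).2 x₀ hz).trans ((extDeriv_smul c (inChart α.1 x₀)).trans ?_)
    rw [← inChart_rawD α.2 x₀ hz]
    rfl

/-- The pullback `f^* : Ω^q(N) → Ω^q(M)` along a smooth map `f : M → N`. -/
noncomputable def pullback [IsManifold 𝓘(ℝ, E) ∞ M] [IsManifold 𝓘(ℝ, E') ∞ N] {f : M → N}
    (hf : ContMDiff 𝓘(ℝ, E) 𝓘(ℝ, E') ∞ f) (q : ℕ) : DiffForm E' N q →ₗ[ℝ] DiffForm E M q where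
  toFun α := ⟨rawPullback f α.1, rawPullback_mem hf α.2⟩
  map_add' _ _ := rfl
  map_smul' _ _ := rfl

end Forms
section Nerve

universe u
variable {E : Type u} [NormedAddCommGroup E] [NormedSpace ℝ E]
  {X : Type*} [TopologicalSpace X] [ChartedSpace E X]
  {E' : Type*} [NormedAddCommGroup E'] [NormedSpace ℝ E']
  {Y : Type*} [TopologicalSpace Y] [ChartedSpace E' Y]
  {f : X → Y}

/-- `N_p(X/Y) = X ×_Y ⋯ ×_Y X` (with `p + 1` factors): the `p`-th level of the nerve of the groupoid
`X ×_Y X ⇉ X`. The submersion property of `f` determines its manifold structure below. -/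
@[ext]
structure CechNerve (_hf : IsSubmersion 𝓘(ℝ, E) 𝓘(ℝ, E') ∞ f) (p : ℕ) where
  /-- The underlying tuple of points. -/
  pt : Fin (p + 1) → X
  /-- All points lie in the same fibre. -/
  fiber : ∀ i j, f (pt i) = f (pt j)

variable (hf : IsSubmersion 𝓘(ℝ, E) 𝓘(ℝ, E') ∞ f)

instance (p : ℕ) : TopologicalSpace (CechNerve hf p) :=
  TopologicalSpace.induced CechNerve.pt inferInstance

theorem continuous_pt (p : ℕ) : Continuous (CechNerve.pt : CechNerve hf p → Fin (p + 1) → X) :=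
  continuous_induced_dom

/-- The chart of `X` at `a` in which `f` is a linear projection. -/
noncomputable def dom (a : X) : OpenPartialHomeomorph X E :=
  (hf.isSubmersionOfComplement_complement a).domChart

/-- The chart of `Y` at `f a` in which `f` is a linear projection. -/
noncomputable def cod (a : X) : OpenPartialHomeomorph Y E' :=
  (hf.isSubmersionOfComplement_complement a).codChart

/-- The splitting of the model space of `X` for which `f` is the first projection in the charts
`dom hf a` and `cod hf a`. -/
noncomputable def split (a : X) : E ≃L[ℝ] E' × hf.complement :=
  (hf.isSubmersionOfComplement_complement a).equiv

theorem mem_dom (a : X) : a ∈ (dom hf a).source :=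
  (hf.isSubmersionOfComplement_complement a).mem_domChart_source

theorem mapsTo_cod (a : X) {x : X} (hx : x ∈ (dom hf a).source) : f x ∈ (cod hf a).source :=
  (hf.isSubmersionOfComplement_complement a).source_subset_preimage_source hx

theorem split_fst (a : X) {x : X} (hx : x ∈ (dom hf a).source) :
    (split hf a (dom hf a x)).1 = cod hf a (f x) := by
  have hw := (hf.isSubmersionOfComplement_complement a).writtenInCharts
  have h := @hw (dom hf a x) (by
    simp only [mfld_simps]
    exact (dom hf a).map_source hx)
  have h2 : (dom hf a).symm (dom hf a x) = x := (dom hf a).left_inv hx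
  simp only [Function.comp, mfld_simps] at h
  change cod hf a (f ((dom hf a).symm (dom hf a x))) = _ at h
  rw [h2] at h
  exact h.symm

/-- The `i`-th point of the tuple with coordinates `z = (y, v)` in the chart around `a`: the point with
coordinates `(y, v i)` in the submersion chart at `a i`, where `y` is transported from the chart
`cod hf (a 0)` to the chart `cod hf (a i)` of `Y`. -/
noncomputable def nervePt {p : ℕ} (a : Fin (p + 1) → X) (z : E' × (Fin (p + 1) → hf.complement))
    (i : Fin (p + 1)) : X :=
  (dom hf (a i)).symm ((split hf (a i)).symm (cod hf (a i) ((cod hf (a 0)).symm z.1), z.2 i))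

/-- The set of coordinates of the chart around `a`. -/
def nerveTarget {p : ℕ} (a : Fin (p + 1) → X) : Set (E' × (Fin (p + 1) → hf.complement)) :=
  ⋂ i, {z | z.1 ∈ ((cod hf (a 0)).symm.trans (cod hf (a i))).source ∧
    (split hf (a i)).symm (cod hf (a i) ((cod hf (a 0)).symm z.1), z.2 i) ∈ (dom hf (a i)).target}

theorem f_nervePt {p : ℕ} (a : Fin (p + 1) → X) {z : E' × (Fin (p + 1) → hf.complement)}
    (hz : z ∈ nerveTarget hf a) (i : Fin (p + 1)) :
    nervePt hf a z i ∈ (dom hf (a i)).source ∧ f (nervePt hf a z i) = (cod hf (a 0)).symm z.1 := by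
  obtain ⟨h1, h2⟩ := mem_iInter.1 hz i
  have h3 : nervePt hf a z i ∈ (dom hf (a i)).source := (dom hf (a i)).map_target h2
  refine ⟨h3, (cod hf (a i)).injOn (mapsTo_cod hf _ h3) (by simpa using h1.2) ?_⟩
  rw [← split_fst hf _ h3, nervePt, (dom hf (a i)).right_inv h2]
  simp

open Classical in
/-- The inverse of the chart around `a` (it takes the value `a` outside of the set of coordinates). -/
noncomputable def nerveInv {p : ℕ} (a : CechNerve hf p) (z : E' × (Fin (p + 1) → hf.complement)) :
    CechNerve hf p :=
  if h : ∀ i j, f (nervePt hf a.1 z i) = f (nervePt hf a.1 z j) then ⟨nervePt hf a.1 z, h⟩ else a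

theorem nerveInv_pt {p : ℕ} (a : CechNerve hf p) {z : E' × (Fin (p + 1) → hf.complement)}
    (hz : z ∈ nerveTarget hf a.1) : (nerveInv hf a z).pt = nervePt hf a.1 z := by
  have h : ∀ i j, f (nervePt hf a.1 z i) = f (nervePt hf a.1 z j) := fun i j =>
    (f_nervePt hf a.1 hz i).2.trans (f_nervePt hf a.1 hz j).2.symm
  rw [nerveInv, dif_pos h]

theorem continuousOn_nervePt {p : ℕ} (a : Fin (p + 1) → X) (i : Fin (p + 1)) :
    ContinuousOn (fun z => nervePt hf a z i) (nerveTarget hf a) := by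
  refine (dom hf (a i)).continuousOn_symm.comp ((split hf (a i)).symm.continuous.comp_continuousOn
    (ContinuousOn.prodMk ?_ ?_)) fun z hz => (mem_iInter.1 hz i).2
  · exact ((cod hf (a 0)).symm.trans (cod hf (a i))).continuousOn.comp continuousOn_fst
      fun z hz => (mem_iInter.1 hz i).1
  · exact ((continuous_apply i).comp continuous_snd).continuousOn

/-- The chart of `N_p(X/Y)` around `a`: it sends `x` to `(f (x 0), v 0, …, v p)`, where `f (x 0)` is read
in a chart of `Y` and `v i` is the fibre coordinate of `x i` in a submersion chart of `X` at `a i`. -/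
noncomputable def nerveChart {p : ℕ} (a : CechNerve hf p) :
    OpenPartialHomeomorph (CechNerve hf p) (E' × (Fin (p + 1) → hf.complement)) where
  toFun x := (cod hf (a.1 0) (f (x.1 0)), fun i => (split hf (a.1 i) (dom hf (a.1 i) (x.1 i))).2)
  invFun := nerveInv hf a
  source := {x | ∀ i, x.1 i ∈ (dom hf (a.1 i)).source}
  target := nerveTarget hf a.1
  map_source' x hx := by
    refine mem_iInter.2 fun i => ?_
    have h0 := mapsTo_cod hf _ (hx 0)
    have hi := mapsTo_cod hf _ (hx i)
    have e0 : (cod hf (a.1 0)).symm (cod hf (a.1 0) (f (x.1 0))) = f (x.1 i) := by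
      rw [(cod hf (a.1 0)).left_inv h0, x.2 0 i]
    refine ⟨?_, ?_⟩
    · simpa [e0, hi] using (cod hf (a.1 0)).map_source h0
    · simp only [e0]
      rw [← split_fst hf _ (hx i)]
      simpa using (dom hf (a.1 i)).map_source (hx i)
  map_target' z hz i := by
    rw [nerveInv_pt hf a hz]
    exact (f_nervePt hf a.1 hz i).1
  left_inv' x hx := by
    have h0 := mapsTo_cod hf _ (hx 0)
    have hx' : nervePt hf a.1 (cod hf (a.1 0) (f (x.1 0)),
        fun i => (split hf (a.1 i) (dom hf (a.1 i) (x.1 i))).2) = x.1 := by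
      funext i
      have e0 : (cod hf (a.1 0)).symm (cod hf (a.1 0) (f (x.1 0))) = f (x.1 i) := by
        rw [(cod hf (a.1 0)).left_inv h0, x.2 0 i]
      simp only [nervePt, e0]
      rw [← split_fst hf _ (hx i)]
      simpa using (dom hf (a.1 i)).left_inv (hx i)
    have h : ∀ i j, f (nervePt hf a.1 _ i) = f (nervePt hf a.1 _ j) := hx' ▸ x.2
    rw [nerveInv, dif_pos h]
    exact CechNerve.ext hx'
  right_inv' z hz := by
    rw [nerveInv_pt hf a hz]
    refine Prod.ext ?_ (funext fun i => ?_)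
    · change cod hf (a.1 0) (f (nervePt hf a.1 z 0)) = z.1
      rw [(f_nervePt hf a.1 hz 0).2]
      have := (mem_iInter.1 hz 0).1.1
      exact (cod hf (a.1 0)).right_inv (by simpa using this)
    · change (split hf (a.1 i) (dom hf (a.1 i) (nervePt hf a.1 z i))).2 = z.2 i
      rw [nervePt, (dom hf (a.1 i)).right_inv (mem_iInter.1 hz i).2]
      simp
  open_source := by
    have : {x : CechNerve hf p | ∀ i, x.1 i ∈ (dom hf (a.1 i)).source} =
      ⋂ i, (fun x : CechNerve hf p => x.1 i) ⁻¹' (dom hf (a.1 i)).source := by ext; simp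
    rw [this]
    exact isOpen_iInter_of_finite fun i => (dom hf (a.1 i)).open_source.preimage
      ((continuous_apply i).comp (continuous_pt hf p))
  open_target := by
    refine isOpen_iInter_of_finite fun i => ?_
    have h1 : IsOpen {z : E' × (Fin (p + 1) → hf.complement) |
        z.1 ∈ ((cod hf (a.1 0)).symm.trans (cod hf (a.1 i))).source} :=
      ((cod hf (a.1 0)).symm.trans (cod hf (a.1 i))).open_source.preimage continuous_fst
    refine ContinuousOn.isOpen_inter_preimage (f := fun z : E' × (Fin (p + 1) → hf.complement) =>
      (split hf (a.1 i)).symm (cod hf (a.1 i) ((cod hf (a.1 0)).symm z.1), z.2 i)) ?_ h1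
      (dom hf (a.1 i)).open_target
    refine (split hf (a.1 i)).symm.continuous.comp_continuousOn (ContinuousOn.prodMk ?_ ?_)
    · exact ((cod hf (a.1 0)).symm.trans (cod hf (a.1 i))).continuousOn.comp continuousOn_fst
        fun z hz => hz
    · exact ((continuous_apply i).comp continuous_snd).continuousOn
  continuousOn_toFun := by
    have hc : ∀ i, Continuous fun x : CechNerve hf p => x.1 i := fun i =>
      (continuous_apply i).comp (continuous_pt hf p)
    refine ContinuousOn.prodMk ?_ (continuousOn_pi.2 fun i => ?_)
    · exact (cod hf (a.1 0)).continuousOn.comp (hf.contMDiff.continuous.comp (hc 0)).continuousOn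
        fun x hx => mapsTo_cod hf _ (hx 0)
    · exact continuous_snd.comp_continuousOn ((split hf (a.1 i)).continuous.comp_continuousOn
        ((dom hf (a.1 i)).continuousOn.comp (hc i).continuousOn fun x hx => hx i))
  continuousOn_invFun := by
    rw [(Topology.IsInducing.induced CechNerve.pt).continuousOn_iff]
    exact (continuousOn_pi.2 (continuousOn_nervePt hf a.1)).congr fun z hz => nerveInv_pt hf a hz

noncomputable instance (p : ℕ) :
    ChartedSpace (E' × (Fin (p + 1) → hf.complement)) (CechNerve hf p) where
  atlas := range (nerveChart hf)
  chartAt := nerveChart hf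
  mem_chart_source a := fun i => mem_dom hf (a.1 i)
  chart_mem_atlas a := mem_range_self a


section Smooth

theorem contMDiffOn_dom (a : X) :
    ContMDiffOn 𝓘(ℝ, E) 𝓘(ℝ, E) ∞ (dom hf a) (dom hf a).source :=
  contMDiffOn_of_mem_maximalAtlas
    (hf.isSubmersionOfComplement_complement a).domChart_mem_maximalAtlas

theorem contMDiffOn_dom_symm (a : X) :
    ContMDiffOn 𝓘(ℝ, E) 𝓘(ℝ, E) ∞ (dom hf a).symm (dom hf a).target :=
  contMDiffOn_symm_of_mem_maximalAtlas
    (hf.isSubmersionOfComplement_complement a).domChart_mem_maximalAtlas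

theorem contMDiffOn_cod (a : X) :
    ContMDiffOn 𝓘(ℝ, E') 𝓘(ℝ, E') ∞ (cod hf a) (cod hf a).source :=
  contMDiffOn_of_mem_maximalAtlas
    (hf.isSubmersionOfComplement_complement a).codChart_mem_maximalAtlas

theorem contMDiffOn_cod_symm (a : X) :
    ContMDiffOn 𝓘(ℝ, E') 𝓘(ℝ, E') ∞ (cod hf a).symm (cod hf a).target :=
  contMDiffOn_symm_of_mem_maximalAtlas
    (hf.isSubmersionOfComplement_complement a).codChart_mem_maximalAtlas

theorem contMDiffOn_nervePt {p : ℕ} (a : Fin (p + 1) → X) (i : Fin (p + 1)) :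
    ContMDiffOn 𝓘(ℝ, E' × (Fin (p + 1) → hf.complement)) 𝓘(ℝ, E) ∞
      (fun z => nervePt hf a z i) (nerveTarget hf a) := by
  refine (contMDiffOn_dom_symm hf (a i)).comp (t := (dom hf (a i)).target) ?_
    fun z hz => (mem_iInter.1 hz i).2
  have h1 : ContMDiffOn 𝓘(ℝ, E') 𝓘(ℝ, E') ∞ (cod hf (a i) ∘ (cod hf (a 0)).symm)
      ((cod hf (a 0)).symm.trans (cod hf (a i))).source :=
    (contMDiffOn_cod hf (a i)).comp ((contMDiffOn_cod_symm hf (a 0)).mono fun y hy => hy.1)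
      fun y hy => hy.2
  have h2 : ContDiffOn ℝ ∞ (cod hf (a i) ∘ (cod hf (a 0)).symm)
      ((cod hf (a 0)).symm.trans (cod hf (a i))).source := contMDiffOn_iff_contDiffOn.1 h1
  refine contMDiffOn_iff_contDiffOn.2 ((split hf (a i)).symm.contDiff.comp_contDiffOn
    (ContDiffOn.prodMk ?_ ?_))
  · exact h2.comp contDiffOn_fst fun z hz => (mem_iInter.1 hz i).1
  · exact ((contDiff_apply ℝ hf.complement i).comp contDiff_snd).contDiffOn

/-- A family of points depending smoothly on a parameter has smooth coordinates. -/
theorem contMDiffAt_coords {p : ℕ} {E₁ : Type*} [NormedAddCommGroup E₁] [NormedSpace ℝ E₁]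
    {M : Type*} [TopologicalSpace M] [ChartedSpace E₁ M] (a : Fin (p + 1) → X)
    {g : M → Fin (p + 1) → X} {m : M}
    (hg : ∀ i, ContMDiffAt 𝓘(ℝ, E₁) 𝓘(ℝ, E) ∞ (fun w => g w i) m)
    (hm : ∀ i, g m i ∈ (dom hf (a i)).source) :
    ContMDiffAt 𝓘(ℝ, E₁) 𝓘(ℝ, E' × (Fin (p + 1) → hf.complement)) ∞
      (fun w => (cod hf (a 0) (f (g w 0)),
        fun i => (split hf (a i) (dom hf (a i) (g w i))).2)) m := by
  have h0 : ContMDiffAt 𝓘(ℝ, E₁) 𝓘(ℝ, E') ∞ (fun w => cod hf (a 0) (f (g w 0))) m := by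
    have h1 : ContMDiffAt 𝓘(ℝ, E₁) 𝓘(ℝ, E') ∞ (fun w => f (g w 0)) m :=
      (hf.contMDiff _).comp m (hg 0)
    exact ((contMDiffOn_cod hf (a 0)).contMDiffAt
      ((cod hf (a 0)).open_source.mem_nhds (mapsTo_cod hf _ (hm 0)))).comp m h1
  refine h0.prodMk_space (contMDiffAt_pi_space.2 fun i => ?_)
  have h2 : ContMDiffAt 𝓘(ℝ, E₁) 𝓘(ℝ, E) ∞ (fun w => dom hf (a i) (g w i)) m :=
    ((contMDiffOn_dom hf (a i)).contMDiffAt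
      ((dom hf (a i)).open_source.mem_nhds (hm i))).comp m (hg i)
  have h3 : ContDiff ℝ ∞ fun v : E => (split hf (a i) v).2 :=
    contDiff_snd.comp (split hf (a i)).contDiff
  exact h3.contMDiff.contMDiffAt.comp m h2

instance (p : ℕ) : IsManifold 𝓘(ℝ, E' × (Fin (p + 1) → hf.complement)) ∞ (CechNerve hf p) := by
  refine isManifold_of_contDiffOn _ _ _ ?_
  rintro _ _ ⟨a, rfl⟩ ⟨b, rfl⟩
  simp only [mfld_simps]
  rw [← contMDiffOn_iff_contDiffOn]
  rintro z ⟨hz, hz'⟩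
  have hn := ((nerveChart hf a).open_target.mem_nhds hz)
  have hz2 : ∀ i, nervePt hf a.pt z i ∈ (dom hf (b.pt i)).source := fun i => by
    have := hz' i
    rwa [show ((nerveChart hf a).symm z).pt = nervePt hf a.1 z from nerveInv_pt hf a hz] at this
  have key := contMDiffAt_coords hf b.pt (g := nervePt hf a.pt) (m := z)
    (fun i => (contMDiffOn_nervePt hf a.pt i).contMDiffAt hn) hz2
  refine (key.congr_of_eventuallyEq ?_).contMDiffWithinAt
  filter_upwards [hn] with w hw
  have : ((nerveChart hf a).symm w).pt = nervePt hf a.1 w := nerveInv_pt hf a hw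
  change (cod hf (b.pt 0) (f (((nerveChart hf a).symm w).pt 0)), _) = _
  simp only [this]

theorem contMDiff_pt (p : ℕ) (i : Fin (p + 1)) :
    ContMDiff 𝓘(ℝ, E' × (Fin (p + 1) → hf.complement)) 𝓘(ℝ, E) ∞
      (fun x : CechNerve hf p => x.pt i) := by
  intro a
  have ha : a ∈ (nerveChart hf a).source := mem_chart_source _ a
  have h1 : ContMDiffAt 𝓘(ℝ, E' × (Fin (p + 1) → hf.complement))
      𝓘(ℝ, E' × (Fin (p + 1) → hf.complement)) ∞ (nerveChart hf a) a :=
    (contMDiffOn_chart (x := a)).contMDiffAt ((nerveChart hf a).open_source.mem_nhds ha)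
  have h2 := (contMDiffOn_nervePt hf a.pt i).contMDiffAt
    ((nerveChart hf a).open_target.mem_nhds ((nerveChart hf a).map_source ha))
  refine (h2.comp a h1).congr_of_eventuallyEq ?_
  filter_upwards [(nerveChart hf a).open_source.mem_nhds ha] with x hx
  have h3 : nerveInv hf a (nerveChart hf a x) = x := (nerveChart hf a).left_inv hx
  change x.pt i = nervePt hf a.pt (nerveChart hf a x) i
  rw [← nerveInv_pt hf a ((nerveChart hf a).map_source hx), h3]

theorem contMDiff_into_nerve {p : ℕ} {E₁ : Type*} [NormedAddCommGroup E₁] [NormedSpace ℝ E₁]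
    {M : Type*} [TopologicalSpace M] [ChartedSpace E₁ M] {g : M → CechNerve hf p}
    (hg : ∀ i, ContMDiff 𝓘(ℝ, E₁) 𝓘(ℝ, E) ∞ (fun w => (g w).pt i)) :
    ContMDiff 𝓘(ℝ, E₁) 𝓘(ℝ, E' × (Fin (p + 1) → hf.complement)) ∞ g := by
  intro m
  rw [contMDiffAt_iff_target]
  refine ⟨?_, ?_⟩
  · exact (continuous_induced_rng.2 (continuous_pi fun i => (hg i).continuous)).continuousAt
  · exact contMDiffAt_coords hf (g m).pt (g := fun w => (g w).pt) (fun i => hg i m)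
      fun i => mem_dom hf _

end Smooth

end Nerve

section Descent

universe u
variable {E : Type u} [NormedAddCommGroup E] [NormedSpace ℝ E]
  {X : Type*} [TopologicalSpace X] [ChartedSpace E X]
  {E' : Type*} [NormedAddCommGroup E'] [NormedSpace ℝ E']
  {Y : Type*} [TopologicalSpace Y] [ChartedSpace E' Y]
  {f : X → Y} (hf : IsSubmersion 𝓘(ℝ, E) 𝓘(ℝ, E') ∞ f)

/-- The face map `d_i : N_(p+1)(X/Y) → N_p(X/Y)`, which omits the `i`-th point. -/
def face (p : ℕ) (i : Fin (p + 2)) (x : CechNerve hf (p + 1)) : CechNerve hf p where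
  pt j := x.pt (i.succAbove j)
  fiber _ _ := x.fiber _ _

/-- The degeneracy map `s_i : N_p(X/Y) → N_(p+1)(X/Y)`, which repeats the `i`-th point. -/
def degen (p : ℕ) (i : Fin (p + 1)) (x : CechNerve hf p) : CechNerve hf (p + 1) where
  pt j := x.pt (i.predAbove j)
  fiber _ _ := x.fiber _ _

/-- The augmentation `N_0(X/Y) = X → Y` given by `f`. -/
def aug (x : CechNerve hf 0) : Y := f (x.pt 0)

theorem contMDiff_face (p : ℕ) (i : Fin (p + 2)) :
    ContMDiff 𝓘(ℝ, E' × (Fin (p + 2) → hf.complement)) 𝓘(ℝ, E' × (Fin (p + 1) → hf.complement)) ∞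
      (face hf p i) :=
  contMDiff_into_nerve hf fun j => contMDiff_pt hf (p + 1) (i.succAbove j)

theorem contMDiff_degen (p : ℕ) (i : Fin (p + 1)) :
    ContMDiff 𝓘(ℝ, E' × (Fin (p + 1) → hf.complement)) 𝓘(ℝ, E' × (Fin (p + 2) → hf.complement)) ∞
      (degen hf p i) :=
  contMDiff_into_nerve hf fun j => contMDiff_pt hf p (i.predAbove j)

theorem contMDiff_aug :
    ContMDiff 𝓘(ℝ, E' × (Fin 1 → hf.complement)) 𝓘(ℝ, E') ∞ (aug hf) :=
  hf.contMDiff.comp (contMDiff_pt hf 0 0)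

/-- `Ω^q(N_p(X/Y))`. -/
abbrev NerveForm (p q : ℕ) : Type _ :=
  DiffForm (E' × (Fin (p + 1) → hf.complement)) (CechNerve hf p) q

/-- The simplicial differential `δ = ∑ i, (-1)^i d_i^* : Ω^q(N_p(X/Y)) → Ω^q(N_(p+1)(X/Y))`. -/
noncomputable def simplicialD (p q : ℕ) : NerveForm hf p q →ₗ[ℝ] NerveForm hf (p + 1) q :=
  ∑ i : Fin (p + 2), (-1 : ℝ) ^ (i : ℕ) • pullback (contMDiff_face hf p i) q

/-- Families with one component in `Ω^q(N_p(X/Y))` for each bidegree `(p, q)`. -/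
abbrev BiForm : Type _ := (p q : ℕ) → NerveForm hf p q

/-- The part of bidegree `(p, q)` of `δ α`. -/
noncomputable def horPart : (p q : ℕ) → BiForm hf →ₗ[ℝ] NerveForm hf p q
  | 0, _ => 0
  | p + 1, q => simplicialD hf p q ∘ₗ LinearMap.proj q ∘ₗ LinearMap.proj p

/-- The part of bidegree `(p, q)` of `(-1)^p d α`. -/
noncomputable def verPart : (p q : ℕ) → BiForm hf →ₗ[ℝ] NerveForm hf p q
  | _, 0 => 0
  | p, q + 1 => (-1 : ℝ) ^ p • (extD q ∘ₗ LinearMap.proj q ∘ₗ LinearMap.proj p)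

/-- The total differential `D = δ + (-1)^p d`. -/
noncomputable def totalD : BiForm hf →ₗ[ℝ] BiForm hf :=
  LinearMap.pi fun p => LinearMap.pi fun q => horPart hf p q + verPart hf p q

/-- The degree `n` part `⨁_(p + q = n) F^k Ω̂^q(N_p(X/Y))` of the `k`-truncated total complex of normalised
forms: components outside of the total degree `n` or of form degree `q < k` vanish, and all pullbacks
along degeneracy maps vanish. -/
noncomputable def totalComplex (k n : ℕ) : Submodule ℝ (BiForm hf) where
  carrier := {α | (∀ p q, p + q ≠ n → α p q = 0) ∧ (∀ p q, q < k → α p q = 0) ∧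
    ∀ p q (i : Fin (p + 1)), pullback (contMDiff_degen hf p i) q (α (p + 1) q) = 0}
  add_mem' {α β} ha hb := by
    refine ⟨fun p q h => ?_, fun p q h => ?_, fun p q i => ?_⟩
    · simp [ha.1 p q h, hb.1 p q h]
    · simp [ha.2.1 p q h, hb.2.1 p q h]
    · exact (map_add (pullback (contMDiff_degen hf p i) q) (α (p + 1) q) (β (p + 1) q)).trans
        ((congrArg₂ (· + ·) (ha.2.2 p q i) (hb.2.2 p q i)).trans (add_zero _))
  zero_mem' := ⟨fun _ _ _ => rfl, fun _ _ _ => rfl, fun _ _ _ => map_zero _⟩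
  smul_mem' c α ha := by
    refine ⟨fun p q h => ?_, fun p q h => ?_, fun p q i => ?_⟩
    · simp [ha.1 p q h]
    · simp [ha.2.1 p q h]
    · exact (map_smul (pullback (contMDiff_degen hf p i) q) c (α (p + 1) q)).trans
        ((congrArg (c • ·) (ha.2.2 p q i)).trans (smul_zero _))

/-- The cocycles of degree `n` in the `k`-truncated total complex. -/
noncomputable def totalCocycles (k n : ℕ) : Submodule ℝ (BiForm hf) :=
  totalComplex hf k n ⊓ (totalD hf).ker

/-- The coboundaries of degree `n` in the `k`-truncated total complex. -/
noncomputable def totalCoboundaries (k : ℕ) : ℕ → Submodule ℝ (BiForm hf)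
  | 0 => ⊥
  | n + 1 => (totalComplex hf k n).map (totalD hf)

/-- The `k`-truncated total cohomology `H_D^n(X_•, F^k Ω̂^•)` of the nerve of `X ×_Y X ⇉ X`. -/
abbrev TotalCohomology (k n : ℕ) : Type _ :=
  totalCocycles hf k n ⧸ (totalCoboundaries hf k n).submoduleOf (totalCocycles hf k n)

theorem rawPullback_comp_aug (i : Fin 2) {q : ℕ} (η : RawForm E' Y q) (x : CechNerve hf 1) :
    rawPullback (E := E' × (Fin 2 → hf.complement)) (face hf 0 i)
      (rawPullback (E := E' × (Fin 1 → hf.complement)) (aug hf) η) x =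
    rawPullback (E := E' × (Fin 2 → hf.complement)) (aug hf ∘ face hf 0 i) η x := by
  have h := mfderiv_comp (f := face hf 0 i) (g := aug hf) x
    ((contMDiff_aug hf).mdifferentiableAt (by simp))
    ((contMDiff_face hf 0 i).mdifferentiableAt (by simp))
  ext v
  change η (aug hf (face hf 0 i x)) _ = η (aug hf (face hf 0 i x)) (fun j => _)
  rw [h]
  rfl

variable [IsManifold 𝓘(ℝ, E') ∞ Y]

section DeRham

variable (E' Y)

/-- `F^k Ω^n(Y)`: all `n`-forms if `k ≤ n`, and zero if `n < k`. -/
def truncForms (k n : ℕ) : Submodule ℝ (DiffForm E' Y n) where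
  carrier := {η | n < k → η = 0}
  add_mem' ha hb h := by rw [ha h, hb h, add_zero]
  zero_mem' _ := rfl
  smul_mem' c _ ha h := by rw [ha h, smul_zero]

/-- The closed forms in `F^k Ω^n(Y)`. -/
noncomputable def deRhamCocycles (k n : ℕ) : Submodule ℝ (DiffForm E' Y n) :=
  truncForms E' Y k n ⊓ (extD n).ker

/-- The differentials of forms in `F^k Ω^(n-1)(Y)`. -/
noncomputable def deRhamCoboundaries (k : ℕ) : (n : ℕ) → Submodule ℝ (DiffForm E' Y n)
  | 0 => ⊥
  | n + 1 => (truncForms E' Y k n).map (extD n)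

/-- The `k`-truncated de Rham cohomology `H_dR^n(Y, F^k Ω^•)`. -/
abbrev DeRhamCohomology (k n : ℕ) : Type _ :=
  deRhamCocycles E' Y k n ⧸ (deRhamCoboundaries E' Y k n).submoduleOf (deRhamCocycles E' Y k n)

end DeRham

/-- `f^*`, as a map from `Ω^n(Y)` to the component of bidegree `(0, n)`. -/
noncomputable def fStar (n : ℕ) : DiffForm E' Y n →ₗ[ℝ] BiForm hf :=
  LinearMap.single ℝ (fun p => (q : ℕ) → NerveForm hf p q) 0 ∘ₗ
    LinearMap.single ℝ (fun q => NerveForm hf 0 q) n ∘ₗ pullback (contMDiff_aug hf) n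

theorem fStar_zero_self (n : ℕ) (η : DiffForm E' Y n) :
    fStar hf n η 0 n = pullback (contMDiff_aug hf) n η := by
  simp [fStar]

theorem fStar_zero_ne (n : ℕ) (η : DiffForm E' Y n) {q : ℕ} (h : q ≠ n) : fStar hf n η 0 q = 0 := by
  simp [fStar, h]

theorem fStar_succ (n : ℕ) (η : DiffForm E' Y n) (p q : ℕ) : fStar hf n η (p + 1) q = 0 := by
  simp [fStar]

theorem simplicialD_aug (q : ℕ) (η : DiffForm E' Y q) :
    simplicialD hf 0 q (pullback (contMDiff_aug hf) q η) = 0 := by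
  have h : aug hf ∘ face hf 0 0 = aug hf ∘ face hf 0 1 := funext fun x => x.fiber _ _
  have h' : pullback (contMDiff_face hf 0 0) q (pullback (contMDiff_aug hf) q η) =
      pullback (contMDiff_face hf 0 1) q (pullback (contMDiff_aug hf) q η) := by
    refine Subtype.ext ?_
    funext x
    refine (rawPullback_comp_aug hf 0 η.1 x).trans (Eq.trans ?_ (rawPullback_comp_aug hf 1 η.1 x).symm)
    rw [h]
  simp [simplicialD, Fin.sum_univ_two, h']

theorem totalD_fStar (n : ℕ) (η : DiffForm E' Y n) :
    totalD hf (fStar hf n η) = fStar hf (n + 1) (extD n η) := by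
  funext p q
  change horPart hf p q _ + verPart hf p q _ = _
  have hh : horPart hf p q (fStar hf n η) = 0 := by
    rcases p with _ | _ | p
    · rfl
    · change simplicialD hf 0 q (fStar hf n η 0 q) = 0
      by_cases h : q = n
      · subst h
        rw [fStar_zero_self, simplicialD_aug]
      · rw [fStar_zero_ne hf n η h, map_zero]
    · change simplicialD hf (p + 1) q (fStar hf n η (p + 1) q) = 0
      rw [fStar_succ, map_zero]
  rw [hh, zero_add]
  rcases q with _ | q
  · rcases p with _ | p
    · rw [fStar_zero_ne hf _ _ (by omega)]; rfl
    · rw [fStar_succ]; rfl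
  · change (-1 : ℝ) ^ p • extD q (fStar hf n η p q) = _
    rcases p with _ | p
    · by_cases h : q = n
      · subst h
        rw [fStar_zero_self, fStar_zero_self, pow_zero, one_smul]
        exact Subtype.ext (rawD_rawPullback (contMDiff_aug hf) η.2)
      · rw [fStar_zero_ne hf n η h, fStar_zero_ne hf _ _ (by omega), map_zero, smul_zero]
    · rw [fStar_succ, fStar_succ, map_zero, smul_zero]

theorem fStar_mem (k n : ℕ) {η : DiffForm E' Y n} (hη : η ∈ truncForms E' Y k n) :
    fStar hf n η ∈ totalComplex hf k n := by
  refine ⟨fun p q h => ?_, fun p q h => ?_, fun p q i => ?_⟩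
  · rcases p with _ | p
    · exact fStar_zero_ne hf n η (by omega)
    · exact fStar_succ hf n η p q
  · rcases p with _ | p
    · by_cases hq : q = n
      · subst hq
        rw [hη h, map_zero]; rfl
      · exact fStar_zero_ne hf n η hq
    · exact fStar_succ hf n η p q
  · rw [fStar_succ, map_zero]

theorem fStar_mem_cocycles (k n : ℕ) {η : DiffForm E' Y n} (hη : η ∈ deRhamCocycles E' Y k n) :
    fStar hf n η ∈ totalCocycles hf k n := by
  refine ⟨fStar_mem hf k n hη.1, ?_⟩
  exact (totalD_fStar hf n η).trans ((congrArg _ (LinearMap.mem_ker.1 hη.2)).trans (map_zero _))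

theorem fStar_mem_coboundaries (k n : ℕ) {η : DiffForm E' Y n}
    (hη : η ∈ deRhamCoboundaries E' Y k n) : fStar hf n η ∈ totalCoboundaries hf k n := by
  rcases n with _ | n
  · rw [(Submodule.mem_bot ℝ).1 hη, map_zero]
    exact Submodule.zero_mem _
  · obtain ⟨θ, hη, rfl⟩ := hη
    exact ⟨fStar hf n θ, fStar_mem hf k n hη, totalD_fStar hf n θ⟩

/-- The map `H_dR^n(Y, F^k Ω^•) → H_D^n(X_•, F^k Ω̂^•)` induced by `f^*`, which sends the class of a closed
form `η` to the class of `f^* η`. -/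
noncomputable def descentMap (k n : ℕ) : DeRhamCohomology E' Y k n →ₗ[ℝ] TotalCohomology hf k n :=
  Submodule.mapQ _ _ ((fStar hf n).restrict fun _ hη => fStar_mem_cocycles hf k n hη)
    fun η hη => fStar_mem_coboundaries hf k n (η := η.1) hη

end Descent

end CechDescent

/-! The proof is the standard double complex argument: the augmented rows `0 → Ω^q(Y) → Ω̂^q(N_0) →
Ω̂^q(N_1) → ⋯` are exact, so the total complex has the cohomology of its augmentation column.
Truncation only discards whole rows and so does not affect this.

For the rows, a submersion has local sections `σ_a : U_a → X`, and by surjectivity the `U_a` cover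
`Y`. Over `U_a` the nerve has the extra degeneracy `s : (x_0, …, x_p) ↦ (σ_a(y), x_0, …, x_p)`, `y`
being the common image of the points. It satisfies `d_0 s = id` and `d_{i+1} s = s d_i`; on `N_0`,
`d_1 s = σ_a ∘ f`. The pullbacks `s^*` are averaged with a partition of unity on `Y`, whose weights
are constant along the fibres and hence pass through all face maps. This gives an operator `h` with
`δ h α = α` whenever `δ α = 0` (`simplicialD_homotopy`), and its analogue at `p = 0`
(`pullback_homotopyAug`, `homotopyAug_pullback`). Since `s s_i = s_{i+1} s`, `h` preserves
normalised forms (`pullback_degen_homotopy`).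

The operator `h` need not commute with `d`, because the weights vary along `Y`; only exactness of
the rows is used. If `D α` is concentrated in the column `p = 0`, then the component of `α` with the
largest `p` is `δ`-closed, and subtracting `D h` of it lowers that `p` (`exists_concentrated`). What
is left at `p = 0` is `δ`-closed, hence pulled back from `Y` (`exists_fStar`). The case `D α = 0`
gives surjectivity on cohomology. The case `D α = f^* η` gives injectivity. In both, injectivity of
`f^*` on forms carries the identities down to `Y`. -/

namespace CechDescent

/-! ### Pullback along maps smooth only on an open set, and gluing of forms -/

section LocalForms

variable {E : Type*} [NormedAddCommGroup E] [NormedSpace ℝ E]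
  {M : Type*} [TopologicalSpace M] [ChartedSpace E M]
  {E' : Type*} [NormedAddCommGroup E'] [NormedSpace ℝ E']
  {N : Type*} [TopologicalSpace N] [ChartedSpace E' N]
  {E'' : Type*} [NormedAddCommGroup E''] [NormedSpace ℝ E'']
  {P : Type*} [TopologicalSpace P] [ChartedSpace E'' P]

theorem rawPullback_rawPullback {q : ℕ} {f : M → N} {g : N → P} {x : M}
    (hg : MDifferentiableAt 𝓘(ℝ, E') 𝓘(ℝ, E'') g (f x))
    (hf : MDifferentiableAt 𝓘(ℝ, E) 𝓘(ℝ, E') f x) (α : RawForm E'' P q) :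
    rawPullback (E := E) f (rawPullback (E := E') g α) x = rawPullback (E := E) (g ∘ f) α x := by
  have h := mfderiv_comp x hg hf
  ext v
  change α (g (f x)) _ = α (g (f x)) (fun j => _)
  rw [h]
  rfl

/-- The pullback at a point involves the derivative of the map, so agreement at the point alone
would not do. This is why identities between local sections are always stated on a neighbourhood
below. -/
theorem rawPullback_congr {q : ℕ} {f g : M → N} {x : M} (h : f =ᶠ[𝓝 x] g) (α : RawForm E' N q) :
    rawPullback (E := E) f α x = rawPullback (E := E) g α x := by
  -- The values of `α` at `f x` and `g x` have different types, being forms on different tangent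
  -- spaces; they are compared as forms on the model space.
  have hα : ∀ (y y' : N), y = y' → ∀ w : Fin q → E', (α y : E' [⋀^Fin q]→L[ℝ] ℝ) w =
    (α y' : E' [⋀^Fin q]→L[ℝ] ℝ) w := by rintro y _ rfl w; rfl
  ext v
  refine (hα _ _ h.eq_of_nhds _).trans (congrArg _ ?_)
  funext i
  have e := h.mfderiv_eq (I := 𝓘(ℝ, E)) (I' := 𝓘(ℝ, E'))
  exact DFunLike.congr_fun e (v i)

theorem inChart_eq_rawPullback {q : ℕ} (α : RawForm E M q) (x₀ : M) (z : E) :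
    inChart α x₀ z = rawPullback (E := E) (M := E) (chartAt E x₀).symm α z := rfl

/-- The pullback of a smooth form is smooth where the map is smooth. -/
theorem contDiffAt_inChart_rawPullback [IsManifold 𝓘(ℝ, E) ∞ M] [IsManifold 𝓘(ℝ, E') ∞ N] {q : ℕ}
    {f : M → N} {V : Set M} (hV : IsOpen V) (hf : ContMDiffOn 𝓘(ℝ, E) 𝓘(ℝ, E') ∞ f V)
    {α : RawForm E' N q} (hα : α ∈ smoothForms E' N q) (x₀ : M) {z : E}
    (hz : z ∈ (chartAt E x₀).target) (hzV : (chartAt E x₀).symm z ∈ V) :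
    ContDiffAt ℝ ∞ (inChart (rawPullback (E := E) f α) x₀) z := by
  set φ := chartAt E x₀
  set y₀ := f (φ.symm z) with hy₀
  set ψ := chartAt E' y₀
  have hφ : ∀ᶠ w in 𝓝 z, w ∈ φ.target ∧ φ.symm w ∈ V :=
    Filter.inter_mem (φ.open_target.mem_nhds hz)
      ((φ.continuousAt_symm hz).preimage_mem_nhds (hV.mem_nhds hzV))
  have hsm : ∀ w, w ∈ φ.target → φ.symm w ∈ V →
      ContMDiffAt 𝓘(ℝ, E) 𝓘(ℝ, E') ∞ (f ∘ φ.symm) w := fun w hw hw' =>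
    (hf.contMDiffAt (hV.mem_nhds hw')).comp w
      ((contMDiffOn_chart_inv x₀).contMDiffAt (φ.open_target.mem_nhds hw))
  have hys : ∀ᶠ w in 𝓝 z, f (φ.symm w) ∈ ψ.source :=
    (hsm z hz hzV).continuousAt.preimage_mem_nhds (ψ.open_source.mem_nhds (mem_chart_source E' y₀))
  have hev : inChart (rawPullback (E := E) f α) x₀ =ᶠ[𝓝 z] fun w =>
      (inChart α y₀ ((ψ ∘ f ∘ φ.symm) w)).compContinuousLinearMap
        (fderiv ℝ (ψ ∘ f ∘ φ.symm) w) := by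
    -- `eventually_nhds` is needed because `ψ.symm ∘ ψ` must cancel on a neighbourhood of each `w`,
    -- not only at `w`, for the pullbacks to agree there.
    filter_upwards [hφ, hys.eventually_nhds] with w hw hw'
    have h1 := (hsm w hw.1 hw.2).mdifferentiableAt (by simp)
    have h2 : MDifferentiableAt 𝓘(ℝ, E) 𝓘(ℝ, E') (ψ ∘ f ∘ φ.symm) w :=
      MDifferentiableAt.comp (g := ψ) (f := f ∘ φ.symm) w (mdiffAt_chart y₀ hw'.self_of_nhds) h1
    have e : ψ.symm ∘ ψ ∘ f ∘ φ.symm =ᶠ[𝓝 w] f ∘ φ.symm := by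
      filter_upwards [hw'] with u hu using ψ.left_inv hu
    rw [inChart_eq_rawPullback, rawPullback_rawPullback
      ((hf.contMDiffAt (hV.mem_nhds hw.2)).mdifferentiableAt (by simp)) (mdiffAt_chart_inv x₀ hw.1),
      ← rawPullback_congr e, ← rawPullback_rawPullback (f := ψ ∘ f ∘ φ.symm) (g := ψ.symm)
        (mdiffAt_chart_inv y₀ (ψ.map_source hw'.self_of_nhds)) h2, ← mfderiv_eq_fderiv]
    rfl
  refine ContDiffAt.congr_of_eventuallyEq ?_ hev
  have hg : ContDiffAt ℝ ∞ (ψ ∘ f ∘ φ.symm) z := by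
    rw [← contMDiffAt_iff_contDiffAt]
    exact ContMDiffAt.comp (g := ψ) (f := f ∘ φ.symm) z
      (contMDiffOn_chart.contMDiffAt (ψ.open_source.mem_nhds (mem_chart_source E' y₀)))
      (hsm z hz hzV)
  have h1 : ContDiffAt ℝ ∞ (inChart α y₀) (ψ y₀) :=
    (hα y₀).contDiffAt (ψ.open_target.mem_nhds (mem_chart_target E' y₀))
  have h2 : ContDiffAt ℝ ∞ (fun w => inChart α y₀ ((ψ ∘ f ∘ φ.symm) w)) z :=
    ContDiffAt.comp z (g := inChart α y₀) h1 hg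
  exact (contDiff_comp_aux q).contDiffAt.comp z (h2.prodMk (hg.fderiv_right (by simp)))

/-- The combination of the forms `β i` on `M` with weights a partition of unity pulled back from `N`. -/
noncomputable def glue {ι : Type*} {q : ℕ} (ρ : SmoothPartitionOfUnity ι 𝓘(ℝ, E') N univ) (π : M → N)
    (β : ι → RawForm E M q) : RawForm E M q := fun x =>
  ∑ i ∈ ρ.finsupport (π x), ρ i (π x) • β i x

theorem rawPullback_glue {ι : Type*} {q : ℕ} (ρ : SmoothPartitionOfUnity ι 𝓘(ℝ, E'') P univ)
    (e : M → N) (π : N → P) (β : ι → RawForm E' N q) (x : M) :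
    rawPullback (E := E) e (glue ρ π β) x =
      ∑ i ∈ ρ.finsupport (π (e x)), ρ i (π (e x)) • rawPullback (E := E) e (β i) x := by
  ext v
  simp [rawPullback, glue, ContinuousAlternatingMap.sum_apply]

/-- Near a given point the sum runs over the finitely many indices whose closed support contains the
image of that point. For these the point lies over `U i`, where `β i` is smooth. The values of `β i`
elsewhere are irrelevant, so the local data may be extended arbitrarily. -/
theorem glue_mem [IsManifold 𝓘(ℝ, E) ∞ M] {ι : Type*} {q : ℕ}
    (ρ : SmoothPartitionOfUnity ι 𝓘(ℝ, E') N univ) {U : ι → Set N} (hU : ρ.IsSubordinate U)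
    {π : M → N} (hπ : ContMDiff 𝓘(ℝ, E) 𝓘(ℝ, E') ∞ π) (β : ι → RawForm E M q)
    (hβ : ∀ i x₀, ∀ z ∈ (chartAt E x₀).target, π ((chartAt E x₀).symm z) ∈ U i →
      ContDiffAt ℝ ∞ (inChart (β i) x₀) z) :
    glue ρ π β ∈ smoothForms E M q := by
  intro x₀ z hz
  set φ := chartAt E x₀
  refine ContDiffAt.contDiffWithinAt ?_
  have hc : ContMDiffAt 𝓘(ℝ, E) 𝓘(ℝ, E') ∞ (π ∘ φ.symm) z :=
    (hπ _).comp z ((contMDiffOn_chart_inv x₀).contMDiffAt (φ.open_target.mem_nhds hz))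
  have hev : inChart (glue ρ π β) x₀ =ᶠ[𝓝 z] fun w =>
      ∑ i ∈ ρ.fintsupport (π (φ.symm z)), ρ i ((π ∘ φ.symm) w) • inChart (β i) x₀ w := by
    filter_upwards [hc.continuousAt.eventually (ρ.eventually_finsupport_subset _)] with w hw
    have h0 : ∀ i ∉ ρ.finsupport ((π ∘ φ.symm) w), ρ i ((π ∘ φ.symm) w) = 0 := fun i hi => by
      by_contra h
      exact hi ((ρ.mem_finsupport _).2 h)
    -- The index set of the sum defining `glue` varies with `w`; enlarging it to a fixed finite set
    -- adds only vanishing terms.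
    refine Eq.trans ?_ (Finset.sum_subset hw fun i _ hi => by rw [h0 i hi, zero_smul])
    exact rawPullback_glue (M := E) ρ φ.symm π β w
  refine ContDiffAt.congr_of_eventuallyEq (ContDiffAt.sum fun i hi => ?_) hev
  refine ContDiffAt.fun_smul ?_ (hβ i x₀ z hz (hU i ((ρ.mem_fintsupport_iff _ i).1 hi)))
  rw [← contMDiffAt_iff_contDiffAt]
  exact ((ρ i).contMDiff _).comp z hc

end LocalForms

/-! ### Local sections and the extra degeneracies of the nerve -/

section ExtraDegeneracy

universe u
variable {E : Type u} [NormedAddCommGroup E] [NormedSpace ℝ E]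
  {X : Type*} [TopologicalSpace X] [ChartedSpace E X]
  {E' : Type*} [NormedAddCommGroup E'] [NormedSpace ℝ E']
  {Y : Type*} [TopologicalSpace Y] [ChartedSpace E' Y]
  {f : X → Y}

/-- A submersion has a smooth local section through every point. -/
theorem exists_local_section (hf : IsSubmersion 𝓘(ℝ, E) 𝓘(ℝ, E') ∞ f) (a : X) :
    ∃ (U : Set Y) (σ : Y → X), IsOpen U ∧ f a ∈ U ∧ ContMDiffOn 𝓘(ℝ, E') 𝓘(ℝ, E) ∞ σ U ∧
      ∀ y ∈ U, f (σ y) = y := by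
  -- In the submersion charts `f` is the projection off the complement; the section keeps the
  -- complement coordinate fixed at its value `c` for `a`.
  set c := (split hf a (dom hf a a)).2
  set g : Y → E := fun y => (split hf a).symm (cod hf a y, c)
  have hg : ContMDiffOn 𝓘(ℝ, E') 𝓘(ℝ, E) ∞ g (cod hf a).source := by
    have h : ContDiff ℝ ∞ fun w : E' => (split hf a).symm (w, c) :=
      (split hf a).symm.contDiff.comp (contDiff_id.prodMk contDiff_const)
    exact h.contMDiff.comp_contMDiffOn (contMDiffOn_cod hf a)
  refine ⟨(cod hf a).source ∩ g ⁻¹' (dom hf a).target, fun y => (dom hf a).symm (g y),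
    hg.continuousOn.isOpen_inter_preimage (cod hf a).open_source (dom hf a).open_target, ?_, ?_, ?_⟩
  · refine ⟨mapsTo_cod hf a (mem_dom hf a), ?_⟩
    have h : (cod hf a (f a), c) = split hf a (dom hf a a) :=
      Prod.ext (split_fst hf a (mem_dom hf a)).symm rfl
    change (split hf a).symm (cod hf a (f a), c) ∈ (dom hf a).target
    rw [h, ContinuousLinearEquiv.symm_apply_apply]
    exact (dom hf a).map_source (mem_dom hf a)
  · exact (contMDiffOn_dom_symm hf a).comp (hg.mono inter_subset_left) fun y hy => hy.2
  · intro y hy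
    have h := (dom hf a).map_target hy.2
    refine (cod hf a).injOn (mapsTo_cod hf a h) hy.1 ?_
    rw [← split_fst hf a h, (dom hf a).right_inv hy.2]
    simp [g]

variable (hf : IsSubmersion 𝓘(ℝ, E) 𝓘(ℝ, E') ∞ f)

theorem contMDiffOn_into_nerve {p : ℕ} {E₁ : Type*} [NormedAddCommGroup E₁] [NormedSpace ℝ E₁]
    {M : Type*} [TopologicalSpace M] [ChartedSpace E₁ M] {g : M → CechNerve hf p} {V : Set M}
    (hV : IsOpen V) (hg : ∀ i, ContMDiffOn 𝓘(ℝ, E₁) 𝓘(ℝ, E) ∞ (fun w => (g w).pt i) V) :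
    ContMDiffOn 𝓘(ℝ, E₁) 𝓘(ℝ, E' × (Fin (p + 1) → hf.complement)) ∞ g V := by
  intro m hm
  have hg' := fun i => (hg i).contMDiffAt (hV.mem_nhds hm)
  refine ContMDiffAt.contMDiffWithinAt ?_
  rw [contMDiffAt_iff_target]
  refine ⟨?_, ?_⟩
  · rw [(Topology.IsInducing.induced CechNerve.pt).continuousAt_iff]
    exact continuousAt_pi.2 fun i => (hg' i).continuousAt
  · exact contMDiffAt_coords hf (g m).pt (g := fun w => (g w).pt) hg' fun i => mem_dom hf _

/-- The common image in `Y` of the points of a tuple. -/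
def base (p : ℕ) (x : CechNerve hf p) : Y := f (x.pt 0)

theorem contMDiff_base (p : ℕ) :
    ContMDiff 𝓘(ℝ, E' × (Fin (p + 1) → hf.complement)) 𝓘(ℝ, E') ∞ (base hf p) :=
  hf.contMDiff.comp (contMDiff_pt hf p 0)

theorem base_face (p : ℕ) (i : Fin (p + 2)) (x : CechNerve hf (p + 1)) :
    base hf p (face hf p i x) = base hf (p + 1) x := x.fiber _ _

theorem base_degen (p : ℕ) (i : Fin (p + 1)) (x : CechNerve hf p) :
    base hf (p + 1) (degen hf p i x) = base hf p x := x.fiber _ _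

/-- The point of `N_0(X/Y) = X` above `y` given by a local section `σ`. -/
def secNerve (σ : Y → X) (y : Y) : CechNerve hf 0 where
  pt _ := σ y
  fiber _ _ := rfl

open Classical in
/-- The extra degeneracy `(x 0, …, x p) ↦ (σ y, x 0, …, x p)`, with `y` the image of the tuple in `Y`,
given by a local section `σ` (with the value `s_0 x` where `σ` is not a section). -/
noncomputable def extraDegen (σ : Y → X) (p : ℕ) (x : CechNerve hf p) : CechNerve hf (p + 1) :=
  if h : f (σ (base hf p x)) = base hf p x then
    ⟨Fin.cons (σ (base hf p x)) x.pt, fun i j => by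
      have : ∀ i : Fin (p + 2), f (Fin.cons (α := fun _ => X) (σ (base hf p x)) x.pt i) =
          base hf p x := Fin.cases h fun j => x.fiber _ _
      rw [this, this]⟩
  else degen hf p 0 x

variable {σ : Y → X}

theorem extraDegen_pt {p : ℕ} {x : CechNerve hf p} (h : f (σ (base hf p x)) = base hf p x) :
    (extraDegen hf σ p x).pt = Fin.cons (σ (base hf p x)) x.pt := by
  rw [extraDegen, dif_pos h]

theorem face_zero_extraDegen {p : ℕ} {x : CechNerve hf p}
    (h : f (σ (base hf p x)) = base hf p x) : face hf p 0 (extraDegen hf σ p x) = x := by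
  refine CechNerve.ext (funext fun j => ?_)
  simp [face, extraDegen_pt hf h]

/-- Faces preserve the image in `Y`, so the same value of `σ` is prepended on both sides. Together
with `face_zero_extraDegen` this makes the extra degeneracy a contraction of the rows. -/
theorem face_succ_extraDegen {p : ℕ} (i : Fin (p + 2)) {x : CechNerve hf (p + 1)}
    (h : f (σ (base hf (p + 1) x)) = base hf (p + 1) x) :
    face hf (p + 1) i.succ (extraDegen hf σ (p + 1) x) = extraDegen hf σ p (face hf p i x) := by
  refine CechNerve.ext (funext fun j => ?_)
  rw [extraDegen_pt hf (by rw [base_face, h]), base_face]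
  simp only [face, extraDegen_pt hf h]
  cases j using Fin.cases <;> simp

theorem face_one_extraDegen {x : CechNerve hf 0} (h : f (σ (base hf 0 x)) = base hf 0 x) :
    face hf 0 1 (extraDegen hf σ 0 x) = secNerve hf σ (base hf 0 x) := by
  refine CechNerve.ext (funext fun j => ?_)
  obtain rfl : j = 0 := Fin.fin_one_eq_zero j
  simp [face, extraDegen_pt hf h, secNerve]

/-- Responsible for the homotopy preserving normalised forms. -/
theorem extraDegen_degen {p : ℕ} (i : Fin (p + 1)) {x : CechNerve hf p}
    (h : f (σ (base hf p x)) = base hf p x) :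
    extraDegen hf σ (p + 1) (degen hf p i x) = degen hf (p + 1) i.succ (extraDegen hf σ p x) := by
  refine CechNerve.ext (funext fun j => ?_)
  rw [extraDegen_pt hf (by rw [base_degen, h]), base_degen]
  simp only [degen, extraDegen_pt hf h]
  cases j using Fin.cases <;> simp

variable {U : Set Y}

theorem contMDiffOn_secNerve (hU : IsOpen U) (hσ : ContMDiffOn 𝓘(ℝ, E') 𝓘(ℝ, E) ∞ σ U) :
    ContMDiffOn 𝓘(ℝ, E') 𝓘(ℝ, E' × (Fin 1 → hf.complement)) ∞ (secNerve hf σ) U :=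
  contMDiffOn_into_nerve hf hU fun _ => hσ

theorem contMDiffOn_extraDegen (hU : IsOpen U) (hσ : ContMDiffOn 𝓘(ℝ, E') 𝓘(ℝ, E) ∞ σ U)
    (hs : ∀ y ∈ U, f (σ y) = y) (p : ℕ) :
    ContMDiffOn 𝓘(ℝ, E' × (Fin (p + 1) → hf.complement))
      𝓘(ℝ, E' × (Fin (p + 2) → hf.complement)) ∞ (extraDegen hf σ p) (base hf p ⁻¹' U) := by
  refine contMDiffOn_into_nerve hf (hU.preimage (contMDiff_base hf p).continuous) fun i => ?_
  cases i using Fin.cases with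
  | zero =>
    refine (hσ.comp (contMDiff_base hf p).contMDiffOn fun x hx => hx).congr fun x hx => ?_
    simp [extraDegen_pt hf (hs _ hx)]
  | succ i =>
    refine (contMDiff_pt hf p i).contMDiffOn.congr fun x hx => ?_
    simp [extraDegen_pt hf (hs _ hx)]

end ExtraDegeneracy

/-! ### Functoriality of the pullback for germs of maps -/

section Square

variable {E : Type*} [NormedAddCommGroup E] [NormedSpace ℝ E]
  {M : Type*} [TopologicalSpace M] [ChartedSpace E M]
  {E₁ : Type*} [NormedAddCommGroup E₁] [NormedSpace ℝ E₁]
  {N₁ : Type*} [TopologicalSpace N₁] [ChartedSpace E₁ N₁]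
  {E₂ : Type*} [NormedAddCommGroup E₂] [NormedSpace ℝ E₂]
  {N₂ : Type*} [TopologicalSpace N₂] [ChartedSpace E₂ N₂]
  {E₃ : Type*} [NormedAddCommGroup E₃] [NormedSpace ℝ E₃]
  {P : Type*} [TopologicalSpace P] [ChartedSpace E₃ P]

theorem rawPullback_square {q : ℕ} {f₁ : M → N₁} {g₁ : N₁ → P} {f₂ : M → N₂} {g₂ : N₂ → P} {x : M}
    (hf₁ : ContMDiffAt 𝓘(ℝ, E) 𝓘(ℝ, E₁) ∞ f₁ x)
    (hg₁ : ContMDiffAt 𝓘(ℝ, E₁) 𝓘(ℝ, E₃) ∞ g₁ (f₁ x))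
    (hf₂ : ContMDiffAt 𝓘(ℝ, E) 𝓘(ℝ, E₂) ∞ f₂ x)
    (hg₂ : ContMDiffAt 𝓘(ℝ, E₂) 𝓘(ℝ, E₃) ∞ g₂ (f₂ x))
    (h : ∀ᶠ w in 𝓝 x, g₁ (f₁ w) = g₂ (f₂ w)) (α : RawForm E₃ P q) :
    rawPullback (E := E) f₁ (rawPullback (E := E₁) g₁ α) x =
      rawPullback (E := E) f₂ (rawPullback (E := E₂) g₂ α) x := by
  rw [rawPullback_rawPullback (hg₁.mdifferentiableAt (by simp)) (hf₁.mdifferentiableAt (by simp)),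
    rawPullback_rawPullback (hg₂.mdifferentiableAt (by simp)) (hf₂.mdifferentiableAt (by simp))]
  exact rawPullback_congr h α

theorem rawPullback_rawPullback_eq_self {q : ℕ} {f : M → N₁} {g : N₁ → M} {x : M}
    (hf : ContMDiffAt 𝓘(ℝ, E) 𝓘(ℝ, E₁) ∞ f x)
    (hg : ContMDiffAt 𝓘(ℝ, E₁) 𝓘(ℝ, E) ∞ g (f x))
    (h : ∀ᶠ w in 𝓝 x, g (f w) = w) (α : RawForm E M q) :
    rawPullback (E := E) f (rawPullback (E := E₁) g α) x = α x := by
  rw [rawPullback_rawPullback (hg.mdifferentiableAt (by simp)) (hf.mdifferentiableAt (by simp)),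
    rawPullback_congr (f := g ∘ f) (g := id) h α, rawPullback_id]

end Square

theorem sum_succ_of_alternating_sum_eq_zero {V : Type*} [AddCommGroup V] [Module ℝ V] {n : ℕ}
    (v : Fin (n + 1) → V) (h : ∑ i : Fin (n + 1), (-1 : ℝ) ^ (i : ℕ) • v i = 0) :
    ∑ i : Fin n, (-1 : ℝ) ^ (i : ℕ) • v i.succ = v 0 := by
  rw [Fin.sum_univ_succ] at h
  simp only [Fin.val_zero, pow_zero, one_smul, Fin.val_succ, pow_succ, mul_neg, mul_one, neg_smul,
    Finset.sum_neg_distrib] at h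
  exact (add_neg_eq_zero.1 h).symm

/-! ### The contracting homotopy and exactness of the augmented rows -/

section Homotopy

universe u
variable {E : Type u} [NormedAddCommGroup E] [NormedSpace ℝ E]
  {X : Type*} [TopologicalSpace X] [ChartedSpace E X]
  {E' : Type*} [NormedAddCommGroup E'] [NormedSpace ℝ E']
  {Y : Type*} [TopologicalSpace Y] [ChartedSpace E' Y]
  {f : X → Y}

variable (E E' f) in
/-- Local sections of `f` on the sets `U a`, and a partition of unity of `Y` subordinate to these. -/
structure LocalSections where
  /-- The domains of the sections. -/
  U : X → Set Y
  /-- The sections. -/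
  σ : X → Y → X
  /-- The partition of unity. -/
  ρ : SmoothPartitionOfUnity X 𝓘(ℝ, E') Y univ
  isOpen_U : ∀ a, IsOpen (U a)
  contMDiffOn_σ : ∀ a, ContMDiffOn 𝓘(ℝ, E') 𝓘(ℝ, E) ∞ (σ a) (U a)
  apply_σ : ∀ a, ∀ y ∈ U a, f (σ a y) = y
  subordinate : ρ.IsSubordinate U

/-- There is one section through each point `a` of `X`, defined near `f a`. Surjectivity of `f`
makes these domains cover `Y`, and finite dimension of `E'` provides the local compactness needed
for a partition of unity. -/
theorem nonempty_localSections [FiniteDimensional ℝ E'] [T2Space Y] [SecondCountableTopology Y]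
    [IsManifold 𝓘(ℝ, E') ∞ Y] (hf : IsSubmersion 𝓘(ℝ, E) 𝓘(ℝ, E') ∞ f)
    (hsurj : Function.Surjective f) : Nonempty (LocalSections E E' f) := by
  choose U σ hU ha hσ hs using exists_local_section hf
  have : LocallyCompactSpace Y := Manifold.locallyCompact_of_finiteDimensional 𝓘(ℝ, E')
  obtain ⟨ρ, hρ⟩ := SmoothPartitionOfUnity.exists_isSubordinate 𝓘(ℝ, E') isClosed_univ U hU
    fun y _ => by
      obtain ⟨a, rfl⟩ := hsurj y
      exact mem_iUnion.2 ⟨a, ha a⟩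
  exact ⟨⟨U, σ, ρ, hU, hσ, hs, hρ⟩⟩

variable (hf : IsSubmersion 𝓘(ℝ, E) 𝓘(ℝ, E') ∞ f) (S : LocalSections E E' f)

theorem LocalSections.mem_U {S : LocalSections E E' f} {y : Y} {a : X}
    (ha : a ∈ S.ρ.finsupport y) : y ∈ S.U a :=
  S.subordinate a (subset_tsupport _ ((S.ρ.mem_finsupport _).1 ha))

/-- The weights add up to one. Identities for the averaged operators thereby reduce to a single
section at a point of its domain. -/
theorem LocalSections.sum_smul {V : Type*} [AddCommGroup V] [Module ℝ V] (y : Y) (g : X → V) (v : V)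
    (hg : ∀ a ∈ S.ρ.finsupport y, g a = v) : ∑ a ∈ S.ρ.finsupport y, S.ρ a y • g a = v := by
  rw [Finset.sum_congr rfl fun a ha => by rw [hg a ha], ← Finset.sum_smul,
    S.ρ.sum_finsupport y (mem_univ y), one_smul]

theorem LocalSections.eventually_mem {p : ℕ} {a : X} {x : CechNerve hf p}
    (hx : base hf p x ∈ S.U a) : ∀ᶠ w in 𝓝 x, base hf p w ∈ S.U a :=
  (contMDiff_base hf p).continuous.continuousAt.preimage_mem_nhds ((S.isOpen_U a).mem_nhds hx)

theorem LocalSections.contMDiffAt_extraDegen {p : ℕ} {a : X} {x : CechNerve hf p}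
    (hx : base hf p x ∈ S.U a) :
    ContMDiffAt 𝓘(ℝ, E' × (Fin (p + 1) → hf.complement))
      𝓘(ℝ, E' × (Fin (p + 2) → hf.complement)) ∞ (extraDegen hf (S.σ a) p) x :=
  (contMDiffOn_extraDegen hf (S.isOpen_U a) (S.contMDiffOn_σ a) (S.apply_σ a) p).contMDiffAt
    (S.eventually_mem hf hx)

theorem LocalSections.contMDiffAt_secNerve {a : X} {y : Y} (hy : y ∈ S.U a) :
    ContMDiffAt 𝓘(ℝ, E') 𝓘(ℝ, E' × (Fin 1 → hf.complement)) ∞ (secNerve hf (S.σ a)) y :=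
  (contMDiffOn_secNerve hf (S.isOpen_U a) (S.contMDiffOn_σ a)).contMDiffAt
    ((S.isOpen_U a).mem_nhds hy)

/-- The contracting homotopy `Ω^q(N_(p+1)) → Ω^q(N_p)`. -/
noncomputable def homotopy (p q : ℕ) (α : NerveForm hf (p + 1) q) : NerveForm hf p q :=
  ⟨glue S.ρ (base hf p) fun a => rawPullback (extraDegen hf (S.σ a) p) α.1,
    glue_mem S.ρ S.subordinate (contMDiff_base hf p) _ fun a x₀ _ hz hzU =>
      contDiffAt_inChart_rawPullback ((S.isOpen_U a).preimage (contMDiff_base hf p).continuous)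
        (contMDiffOn_extraDegen hf (S.isOpen_U a) (S.contMDiffOn_σ a) (S.apply_σ a) p) α.2 x₀ hz hzU⟩

/-- The contracting homotopy `Ω^q(N_0) → Ω^q(Y)`. -/
noncomputable def homotopyAug [IsManifold 𝓘(ℝ, E') ∞ Y] (q : ℕ) (α : NerveForm hf 0 q) :
    DiffForm E' Y q :=
  ⟨glue S.ρ id fun a => rawPullback (secNerve hf (S.σ a)) α.1,
    glue_mem S.ρ S.subordinate contMDiff_id _ fun a x₀ _ hz hzU =>
      contDiffAt_inChart_rawPullback (S.isOpen_U a)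
        (contMDiffOn_secNerve hf (S.isOpen_U a) (S.contMDiffOn_σ a)) α.2 x₀ hz hzU⟩

theorem simplicialD_apply (p q : ℕ) (α : NerveForm hf p q) (x : CechNerve hf (p + 1)) :
    (simplicialD hf p q α).1 x = ∑ i : Fin (p + 2), (-1 : ℝ) ^ (i : ℕ) •
      rawPullback (E := E' × (Fin (p + 2) → hf.complement)) (face hf p i) α.1 x := by
  have h : (simplicialD hf p q α).1 = ∑ i : Fin (p + 2), (-1 : ℝ) ^ (i : ℕ) •
      rawPullback (E := E' × (Fin (p + 2) → hf.complement)) (face hf p i) α.1 := by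
    change (smoothForms _ _ q).subtype (simplicialD hf p q α) = _
    rw [simplicialD, LinearMap.sum_apply]
    refine (map_sum (smoothForms _ _ q).subtype _ _).trans ?_
    rfl
  rw [h, Finset.sum_apply]
  rfl

theorem rawPullback_simplicialD {E₁ : Type*} [NormedAddCommGroup E₁] [NormedSpace ℝ E₁]
    {M : Type*} [TopologicalSpace M] [ChartedSpace E₁ M] (p q : ℕ) (α : NerveForm hf p q)
    (h : M → CechNerve hf (p + 1)) (x : M) :
    rawPullback (E := E₁) h (simplicialD hf p q α).1 x = ∑ i : Fin (p + 2), (-1 : ℝ) ^ (i : ℕ) •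
      rawPullback (E := E₁) h
        (rawPullback (E := E' × (Fin (p + 2) → hf.complement)) (face hf p i) α.1) x := by
  ext v
  have e := DFunLike.congr_fun (simplicialD_apply hf p q α (h x)) fun i =>
    mfderiv 𝓘(ℝ, E₁) 𝓘(ℝ, E' × (Fin (p + 2) → hf.complement)) h x (v i)
  refine e.trans ?_
  simp only [ContinuousAlternatingMap.sum_apply]
  rfl

variable {hf S}

/-- Pull `δ α = 0` back along the extra degeneracy: the term of `d_0` is `α` itself, and the other
terms, moved to the other side, change sign. -/
theorem rawPullback_extraDegen_eq {p q : ℕ} {α : NerveForm hf p q} (hα : simplicialD hf p q α = 0)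
    {a : X} {x : CechNerve hf p} (hx : base hf p x ∈ S.U a) :
    ∑ i : Fin (p + 1), (-1 : ℝ) ^ (i : ℕ) •
      rawPullback (E := E' × (Fin (p + 1) → hf.complement)) (extraDegen hf (S.σ a) p)
        (rawPullback (E := E' × (Fin (p + 2) → hf.complement)) (face hf p i.succ) α.1) x = α.1 x := by
  have h := rawPullback_simplicialD (E₁ := E' × (Fin (p + 1) → hf.complement)) hf p q α
    (extraDegen hf (S.σ a) p) x
  rw [hα] at h
  refine (sum_succ_of_alternating_sum_eq_zero _ h.symm).trans ?_
  exact rawPullback_rawPullback_eq_self (S.contMDiffAt_extraDegen hf hx)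
    (contMDiff_face hf p 0 _) ((S.eventually_mem hf hx).mono fun w hw =>
      face_zero_extraDegen hf (S.apply_σ a _ hw)) α.1

/-- Exactness of the rows at `p + 1`. The weights depend only on the image in `Y`, which faces
preserve, so `d_i^*` acts under the sum over sections. There `d_i^* s^* = s^* d_{i+1}^*`, and
`rawPullback_extraDegen_eq` applies. -/
theorem simplicialD_homotopy {p q : ℕ} {α : NerveForm hf (p + 1) q}
    (hα : simplicialD hf (p + 1) q α = 0) : simplicialD hf p q (homotopy hf S p q α) = α := by
  refine Subtype.ext (funext fun x => ?_)
  rw [simplicialD_apply]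
  simp only [homotopy, rawPullback_glue, base_face, Finset.smul_sum]
  -- The sum over sections is taken outside, so that each section can be treated separately.
  rw [Finset.sum_comm]
  simp only [smul_comm _ (S.ρ _ _), ← Finset.smul_sum]
  refine S.sum_smul _ _ _ fun a ha => ?_
  have hx := LocalSections.mem_U ha
  rw [← rawPullback_extraDegen_eq hα hx]
  refine Finset.sum_congr rfl fun i _ => congrArg _ ?_
  refine rawPullback_square (contMDiff_face hf p i x) (S.contMDiffAt_extraDegen hf ?_)
    (S.contMDiffAt_extraDegen hf hx) (contMDiff_face hf (p + 1) i.succ _) ?_ α.1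
  · rwa [base_face]
  · exact (S.eventually_mem hf hx).mono fun w hw =>
      (face_succ_extraDegen hf i (S.apply_σ a _ hw)).symm

theorem pullback_degen_homotopy {p q : ℕ} {α : NerveForm hf (p + 2) q} (i : Fin (p + 1))
    (hα : pullback (contMDiff_degen hf (p + 1) i.succ) q α = 0) :
    pullback (contMDiff_degen hf p i) q (homotopy hf S (p + 1) q α) = 0 := by
  refine Subtype.ext (funext fun x => ?_)
  change rawPullback (E := E' × (Fin (p + 1) → hf.complement)) (degen hf p i)
    (glue S.ρ (base hf (p + 1)) _) x = 0
  rw [rawPullback_glue]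
  simp only [base_degen]
  refine S.sum_smul _ _ _ fun a ha => ?_
  have hx := LocalSections.mem_U ha
  rw [rawPullback_square (contMDiff_degen hf p i x) (S.contMDiffAt_extraDegen hf
    (by rwa [base_degen])) (S.contMDiffAt_extraDegen hf hx) (contMDiff_degen hf (p + 1) i.succ _)
    ((S.eventually_mem hf hx).mono fun w hw => extraDegen_degen hf i (S.apply_σ a _ hw)) α.1]
  have h : rawPullback (E := E' × (Fin (p + 2) → hf.complement)) (degen hf (p + 1) i.succ) α.1 = 0 :=
    congrArg Subtype.val hα
  rw [h]
  rfl

variable [IsManifold 𝓘(ℝ, E') ∞ Y]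

/-- Descent of forms: for `p = 0` only `d_1` remains in `rawPullback_extraDegen_eq`, and `d_1 s`
factors through `Y` as `σ ∘ f`. -/
theorem pullback_homotopyAug {q : ℕ} {α : NerveForm hf 0 q} (hα : simplicialD hf 0 q α = 0) :
    pullback (contMDiff_aug hf) q (homotopyAug hf S q α) = α := by
  refine Subtype.ext (funext fun x => ?_)
  change rawPullback (E := E' × (Fin 1 → hf.complement)) (aug hf) (glue S.ρ id _) x = α.1 x
  rw [rawPullback_glue]
  refine S.sum_smul _ _ _ fun a ha => ?_
  have hx : base hf 0 x ∈ S.U a := LocalSections.mem_U ha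
  have h := rawPullback_extraDegen_eq hα hx
  rw [Fin.sum_univ_one] at h
  simp only [Fin.val_zero, pow_zero, one_smul] at h
  rw [← h]
  exact rawPullback_square (contMDiff_aug hf x) (S.contMDiffAt_secNerve hf hx)
    (S.contMDiffAt_extraDegen hf hx) (contMDiff_face hf 0 1 _)
    ((S.eventually_mem hf hx).mono fun w hw => (face_one_extraDegen hf (S.apply_σ a _ hw)).symm) α.1

theorem homotopyAug_pullback {q : ℕ} (η : DiffForm E' Y q) :
    homotopyAug hf S q (pullback (contMDiff_aug hf) q η) = η := by
  refine Subtype.ext (funext fun y => ?_)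
  refine S.sum_smul _ _ _ fun a ha => ?_
  have hy : y ∈ S.U a := LocalSections.mem_U ha
  refine rawPullback_rawPullback_eq_self (S.contMDiffAt_secNerve hf hy) (contMDiff_aug hf _) ?_ η.1
  filter_upwards [(S.isOpen_U a).mem_nhds hy] with w hw using S.apply_σ a w hw

end Homotopy

/-! ### The total differential -/

section Total

theorem extD_pullback {E : Type*} [NormedAddCommGroup E] [NormedSpace ℝ E]
    {M : Type*} [TopologicalSpace M] [ChartedSpace E M] [IsManifold 𝓘(ℝ, E) ∞ M]
    {E' : Type*} [NormedAddCommGroup E'] [NormedSpace ℝ E']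
    {N : Type*} [TopologicalSpace N] [ChartedSpace E' N] [IsManifold 𝓘(ℝ, E') ∞ N]
    {f : M → N} (hf : ContMDiff 𝓘(ℝ, E) 𝓘(ℝ, E') ∞ f) {q : ℕ} (α : DiffForm E' N q) :
    extD q (pullback hf q α) = pullback hf (q + 1) (extD q α) :=
  Subtype.ext (rawD_rawPullback hf α.2)

theorem extD_extD {E : Type*} [NormedAddCommGroup E] [NormedSpace ℝ E]
    {M : Type*} [TopologicalSpace M] [ChartedSpace E M] [IsManifold 𝓘(ℝ, E) ∞ M] {q : ℕ}
    (α : DiffForm E M q) : extD (q + 1) (extD q α) = 0 :=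
  Subtype.ext (rawD_rawD α.2)

universe u
variable {E : Type u} [NormedAddCommGroup E] [NormedSpace ℝ E]
  {X : Type*} [TopologicalSpace X] [ChartedSpace E X]
  {E' : Type*} [NormedAddCommGroup E'] [NormedSpace ℝ E']
  {Y : Type*} [TopologicalSpace Y] [ChartedSpace E' Y]
  {f : X → Y} (hf : IsSubmersion 𝓘(ℝ, E) 𝓘(ℝ, E') ∞ f)

theorem extD_simplicialD (p q : ℕ) (α : NerveForm hf p q) :
    extD q (simplicialD hf p q α) = simplicialD hf p (q + 1) (extD q α) := by
  simp only [simplicialD, LinearMap.sum_apply, LinearMap.smul_apply, map_sum, map_smul,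
    extD_pullback]

theorem totalD_zero_zero (α : BiForm hf) : totalD hf α 0 0 = 0 := add_zero _

theorem totalD_zero_succ (α : BiForm hf) (q : ℕ) : totalD hf α 0 (q + 1) = extD q (α 0 q) := by
  change 0 + (-1 : ℝ) ^ 0 • extD q (α 0 q) = _
  simp

theorem totalD_succ_zero (α : BiForm hf) (p : ℕ) :
    totalD hf α (p + 1) 0 = simplicialD hf p 0 (α p 0) := add_zero _

theorem totalD_succ_succ (α : BiForm hf) (p q : ℕ) : totalD hf α (p + 1) (q + 1) =
    simplicialD hf p (q + 1) (α p (q + 1)) + (-1 : ℝ) ^ (p + 1) • extD q (α (p + 1) q) := rfl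

variable {hf}

/-- The mixed terms cancel by the sign `(-1)^p`, since `d` commutes with `δ`. The identity `δ δ = 0`
is assumed for `β` only: in the application `δ β` is, column by column, either zero or a `δ`-closed
component of a given `α`. -/
theorem totalD_totalD {β : BiForm hf}
    (hβ : ∀ p q, simplicialD hf (p + 1) q (simplicialD hf p q (β p q)) = 0) :
    totalD hf (totalD hf β) = 0 := by
  funext p q
  rcases p with _ | p <;> rcases q with _ | q
  · exact totalD_zero_zero hf _
  · rw [totalD_zero_succ]
    rcases q with _ | q
    · rw [totalD_zero_zero, map_zero]; rfl
    · rw [totalD_zero_succ, extD_extD]; rfl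
  · rw [totalD_succ_zero]
    rcases p with _ | p
    · rw [totalD_zero_zero, map_zero]; rfl
    · rw [totalD_succ_zero, hβ]; rfl
  · have h1 : simplicialD hf p (q + 1) (totalD hf β p (q + 1)) =
        (-1 : ℝ) ^ p • simplicialD hf p (q + 1) (extD q (β p q)) := by
      rcases p with _ | p
      · rw [totalD_zero_succ, pow_zero, one_smul]
      · rw [totalD_succ_succ, map_add, hβ, zero_add, map_smul]
    have h2 : extD q (totalD hf β (p + 1) q) = extD q (simplicialD hf p q (β p q)) := by
      rcases q with _ | q
      · rw [totalD_succ_zero]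
      · rw [totalD_succ_succ, map_add, map_smul, extD_extD, smul_zero, add_zero]
    rw [totalD_succ_succ, h1, h2, extD_simplicialD, pow_succ, mul_neg, mul_one, neg_smul,
      add_neg_cancel]
    rfl

/-- The part `d β` is normalised because `d` commutes with the degeneracies. That `δ β` is
normalised is assumed; in the application its components are zero or components of a normalised `α`.
-/
theorem totalD_mem {k n : ℕ} {β : BiForm hf} (hβ : β ∈ totalComplex hf k n)
    (hδ : ∀ p q i, pullback (contMDiff_degen hf p i) q (simplicialD hf p q (β p q)) = 0) :
    totalD hf β ∈ totalComplex hf k (n + 1) := by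
  obtain ⟨h1, h2, h3⟩ := hβ
  refine ⟨fun p q h => ?_, fun p q h => ?_, fun p q i => ?_⟩
  · rcases p with _ | p <;> rcases q with _ | q
    · exact totalD_zero_zero hf _
    · rw [totalD_zero_succ, h1 _ _ (by omega), map_zero]
    · rw [totalD_succ_zero, h1 _ _ (by omega), map_zero]
    · rw [totalD_succ_succ, h1 _ _ (by omega), h1 _ _ (by omega), map_zero, map_zero, smul_zero,
        add_zero]
  · rcases p with _ | p <;> rcases q with _ | q
    · exact totalD_zero_zero hf _
    · rw [totalD_zero_succ, h2 _ _ (by omega), map_zero]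
    · rw [totalD_succ_zero, h2 _ _ (by omega), map_zero]
    · rw [totalD_succ_succ, h2 _ _ (by omega), h2 _ _ (by omega), map_zero, map_zero, smul_zero,
        add_zero]
  · rcases q with _ | q
    · rw [totalD_succ_zero, hδ]
    · rw [totalD_succ_succ, map_add, hδ, map_smul, ← extD_pullback, h3, map_zero, smul_zero,
        add_zero]

/-! ### Reduction of the total complex to the column `p = 0` -/

theorem homotopy_zero (S : LocalSections E E' f) (p q : ℕ) : homotopy hf S p q 0 = 0 :=
  Subtype.ext (funext fun x => S.sum_smul (base hf p x) _ _ fun _ _ => rfl)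

/-- The homotopy applied to the components of `α` with `p = m + 1`. -/
noncomputable def columnHomotopy (S : LocalSections E E' f) (m : ℕ) (α : BiForm hf) : BiForm hf := fun p q =>
  if p = m then homotopy hf S p q (α (p + 1) q) else 0

theorem columnHomotopy_mem (S : LocalSections E E' f) {k n : ℕ} {α : BiForm hf} (hα : α ∈ totalComplex hf k (n + 1)) (m : ℕ) :
    columnHomotopy S m α ∈ totalComplex hf k n := by
  obtain ⟨h1, h2, h3⟩ := hα
  refine ⟨fun p q h => ?_, fun p q h => ?_, fun p q i => ?_⟩
  · rw [columnHomotopy, h1 _ _ (by omega), homotopy_zero, ite_self]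
  · rw [columnHomotopy, h2 _ _ h, homotopy_zero, ite_self]
  · rw [columnHomotopy]
    split_ifs
    · exact pullback_degen_homotopy i (h3 _ _ _)
    · rw [map_zero]

theorem simplicialD_columnHomotopy (S : LocalSections E E' f) {m : ℕ} {α : BiForm hf}
    (hα : ∀ q, simplicialD hf (m + 1) q (α (m + 1) q) = 0) (p q : ℕ) :
    simplicialD hf p q (columnHomotopy S m α p q) = if p = m then α (p + 1) q else 0 := by
  rw [columnHomotopy]
  split_ifs with h
  · subst h
    exact simplicialD_homotopy (hα q)
  · rw [map_zero]

/-- An element of the total complex whose differential is concentrated in `p = 0` can be moved to `p = 0`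
by a coboundary. -/
theorem exists_concentrated (S : LocalSections E E' f) {k n : ℕ} (m : ℕ) {α : BiForm hf} (hα : α ∈ totalComplex hf k n)
    (hm : ∀ p q, m < p → α p q = 0) (hD : ∀ p q, totalD hf α (p + 1) q = 0) :
    ∃ α' ∈ totalComplex hf k n, (∀ p q, α' (p + 1) q = 0) ∧ totalD hf α' = totalD hf α ∧
      α - α' ∈ totalCoboundaries hf k n := by
  induction m generalizing α with
  | zero =>
    exact ⟨α, hα, fun p q => hm _ _ (by omega), rfl, by rw [sub_self]; exact Submodule.zero_mem _⟩
  | succ m ih =>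
    rcases n with _ | n
    -- In total degree `0` only the component `p = q = 0` survives, so the smaller bound already
    -- holds.
    · exact ih hα (fun p q h => hα.1 p q (by omega)) hD
    -- In column `m + 2` of `D α` the `d`-term vanishes, as `m + 1` is the last column of `α`.
    have hδ : ∀ q, simplicialD hf (m + 1) q (α (m + 1) q) = 0 := fun q => by
      have h := hD (m + 1) q
      rcases q with _ | q
      · rwa [totalD_succ_zero] at h
      · rwa [totalD_succ_succ, hm (m + 1 + 1) _ (by omega), map_zero, smul_zero, add_zero] at h
    have hs := simplicialD_columnHomotopy S hδ
    set β := columnHomotopy S m α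
    have hβ : β ∈ totalComplex hf k n := columnHomotopy_mem S hα m
    have hDD : totalD hf (totalD hf β) = 0 := totalD_totalD fun p q => by
      rw [hs]
      split_ifs with h
      · subst h
        exact hδ q
      · rw [map_zero]
    have hDβ : totalD hf β ∈ totalComplex hf k (n + 1) := totalD_mem hβ fun p q i => by
      rw [hs]
      split_ifs
      · exact hα.2.2 p q i
      · rw [map_zero]
    have hD' : totalD hf (α - totalD hf β) = totalD hf α := by rw [map_sub, hDD, sub_zero]
    -- Beyond column `m`, where `β` lives, `D β` has only its `δ`-part. It equals `α` in column `m +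
    -- 1`, and both vanish further on.
    have hm' : ∀ p q, m < p → (α - totalD hf β) p q = 0 := fun p q h => by
      obtain ⟨p, rfl⟩ : ∃ r, p = r + 1 := ⟨p - 1, by omega⟩
      have hc : ∀ q, β (p + 1) q = 0 := fun q => if_neg (by omega)
      have h6 : totalD hf β (p + 1) q = α (p + 1) q := by
        have h7 : simplicialD hf p q (β p q) = α (p + 1) q := by
          rw [hs]
          split_ifs
          · rfl
          · exact (hm _ _ (by omega)).symm
        rcases q with _ | q
        · rw [totalD_succ_zero, h7]
        · rw [totalD_succ_succ, h7, hc, map_zero, smul_zero, add_zero]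
      change α (p + 1) q - totalD hf β (p + 1) q = 0
      rw [h6, sub_self]
    obtain ⟨α', h1, h2, h3, h4⟩ := ih (Submodule.sub_mem _ hα hDβ) hm' (by rwa [hD'])
    refine ⟨α', h1, h2, h3.trans hD', ?_⟩
    have h5 := Submodule.add_mem _ h4 (⟨β, hβ, rfl⟩ : totalD hf β ∈ totalCoboundaries hf k (n + 1))
    rwa [sub_right_comm, sub_add_cancel] at h5

variable [IsManifold 𝓘(ℝ, E') ∞ Y]

theorem pullback_aug_injective (S : LocalSections E E' f) (q : ℕ) : Function.Injective (pullback (contMDiff_aug hf) q) :=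
  Function.LeftInverse.injective (g := homotopyAug hf S q) fun η => homotopyAug_pullback η

theorem fStar_injective (S : LocalSections E E' f) (n : ℕ) : Function.Injective (fStar hf n) := fun η θ h => by
  have h' := congrFun (congrFun h 0) n
  rw [fStar_zero_self, fStar_zero_self] at h'
  exact pullback_aug_injective S n h'

/-- An element of the total complex whose differential is concentrated in `p = 0` is a form on `Y` up to
a coboundary. -/
theorem exists_fStar (S : LocalSections E E' f) {k n : ℕ} {α : BiForm hf} (hα : α ∈ totalComplex hf k n)
    (hD : ∀ p q, totalD hf α (p + 1) q = 0) :
    ∃ η ∈ truncForms E' Y k n, totalD hf (fStar hf n η) = totalD hf α ∧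
      α - fStar hf n η ∈ totalCoboundaries hf k n := by
  obtain ⟨α', h1, h2, h3, h4⟩ := exists_concentrated S n hα (fun p q h => hα.1 p q (by omega)) hD
  -- In column `1` of `D α'` only the `δ`-term survives.
  have hδ : simplicialD hf 0 n (α' 0 n) = 0 := by
    have h := hD 0 n
    rw [← h3] at h
    rcases n with _ | n
    · rwa [totalD_succ_zero] at h
    · rwa [totalD_succ_succ, h2, map_zero, smul_zero, add_zero] at h
  have hη := pullback_homotopyAug (S := S) hδ
  set η := homotopyAug hf S n (α' 0 n)
  have he : fStar hf n η = α' := by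
    funext p q
    rcases p with _ | p
    · by_cases h : q = n
      · subst h
        rw [fStar_zero_self, hη]
      · rw [fStar_zero_ne hf n η h, h1.1 _ _ (by omega)]
    · rw [fStar_succ, h2]
  -- The truncation condition on `η` is inherited from `α'`: if `n < k`, then `f^* η` vanishes,
  -- hence so does `η`.
  refine ⟨η, fun hk => pullback_aug_injective (hf := hf) S n ?_, by rw [he, h3], by rwa [he]⟩
  rw [hη, h1.2.1 _ _ hk, map_zero]

theorem descentMap_bijective (S : LocalSections E E' f) (k n : ℕ) : Function.Bijective (descentMap hf k n :
    DeRhamCohomology E' Y k n →ₗ[ℝ] TotalCohomology hf k n) := by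
  constructor
  · rw [injective_iff_map_eq_zero]
    intro x
    obtain ⟨⟨η, hη⟩, rfl⟩ := Submodule.Quotient.mk_surjective _ x
    intro h
    have h' : fStar hf n η ∈ totalCoboundaries hf k n :=
      (Submodule.Quotient.mk_eq_zero
        ((totalCoboundaries hf k n).submoduleOf (totalCocycles hf k n))).1 h
    refine (Submodule.Quotient.mk_eq_zero _).2 ?_
    change η ∈ deRhamCoboundaries E' Y k n
    rcases n with _ | n
    · exact (Submodule.mem_bot ℝ).2 (fStar_injective S 0
        (((Submodule.mem_bot ℝ).1 h').trans (map_zero _).symm))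
    · obtain ⟨β, hβ, hβη⟩ := h'
      -- The primitive `β` need not be closed, but `D β = f^* η` lies in the column `p = 0`. It can
      -- thus be replaced by some `f^* θ` with the same differential, and then `f^*(d θ) = f^* η`.
      obtain ⟨θ, hθ, h1, -⟩ := exists_fStar S hβ fun p q => by rw [hβη, fStar_succ]
      refine ⟨θ, hθ, fStar_injective (hf := hf) S (n + 1) ?_⟩
      rw [← totalD_fStar, h1, hβη]
  · intro x
    obtain ⟨⟨α, hα⟩, rfl⟩ := Submodule.Quotient.mk_surjective _ x
    have h0 : totalD hf α = 0 := hα.2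
    obtain ⟨η, hη, h1, h2⟩ := exists_fStar S hα.1 fun p q => by rw [h0]; rfl
    -- `η` is closed because `f^*(d η) = D f^* η = D α = 0`.
    have hc : extD n η = 0 := fStar_injective (hf := hf) S (n + 1) (by
      rw [← totalD_fStar, h1, h0, map_zero])
    refine ⟨Submodule.Quotient.mk ⟨η, hη, hc⟩, ((Submodule.Quotient.eq _).2 ?_).symm⟩
    exact h2

end Total

end CechDescent

theorem mainTheorem3
    {E : Type*} [NormedAddCommGroup E] [NormedSpace ℝ E] [FiniteDimensional ℝ E]
    {X : Type*} [TopologicalSpace X] [T2Space X] [SecondCountableTopology X]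
    [ChartedSpace E X] [IsManifold 𝓘(ℝ, E) ∞ X]
    {E' : Type*} [NormedAddCommGroup E'] [NormedSpace ℝ E'] [FiniteDimensional ℝ E']
    {Y : Type*} [TopologicalSpace Y] [T2Space Y] [SecondCountableTopology Y]
    [ChartedSpace E' Y] [IsManifold 𝓘(ℝ, E') ∞ Y]
    (f : X → Y) (hf : IsSubmersion 𝓘(ℝ, E) 𝓘(ℝ, E') ∞ f) (hsurj : Function.Surjective f)
    (k n : ℕ) :
    Function.Bijective (CechDescent.descentMap hf k n :
      CechDescent.DeRhamCohomology E' Y k n →ₗ[ℝ] CechDescent.TotalCohomology hf k n) := by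
  obtain ⟨S⟩ := CechDescent.nonempty_localSections hf hsurj
  exact CechDescent.descentMap_bijective S k n
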